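/- For integers $p\ge 1$, $j\ge 0$ and $n\ge 0$ let $\mathsf{Mod}_{p,j}:\mathbb F_2^n\to\mathbb F_2$ be the function with $\mathsf{Mod}_{p,j}(\mathbf x)=0$ if the Hamming weight satisfies $|\mathbf x|\equiv j \pmod p$, and $\mathsf{Mod}_{p,j}(\mathbf x)=1$ otherwise. A hybrid circuit on $n$ input bits with oracle $g=(g_m:\mathbb F_2^m\to\mathbb F_2)_{m\ge 0}$ has $n$ read-only classical input bits, finitely many classical work bits (initially $0$) and finitely many qubits (initially $|0\rangle$). It consists of consecutive layers of the following operations: unitary gates on some qubits, where the choice of the unitary may depend on the values of some classical bits (the fan-in of the gate is the number of these qubits and classical bits together); computational-basis measurements of a qubit, with the outcome stored in a work bit; and calls of the classical oracle $g_m$, for any $m$, on $m$ classical bits, with the answer stored in a work bit. Operations in the same layer use disjoint wires, except that several oracle calls may read the same classical bits. The depth is the number of layers, and the size is the number of wires plus the total size of all operations (each counted by its number of wires, plus one for a gate). A family $f=(f_n)_{n\ge 0}$ of Boolean functions is $\mathsf{QNC}^0$-reducible to $g$ if there are constants $b,d$ and a polynomial $P$ such that for every $n$ some hybrid circuit with oracle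 $g$, with all gates of fan-in at most $b$, depth at most $d$ and size at most $P(n)$, has on every input $\mathbf x\in\mathbb F_2^n$ a designated classical bit equal to $f_n(\mathbf x)$ at the end with probability $1$. **Corollary.** For every prime number $p$, the function $\mathsf{Mod}_{p,0}$ is $\mathsf{QNC}^0$-reducible to $\mathsf{Mod}_{2,0}$. -/

import Mathlib

/-- A family of Boolean functions, one for each input length. -/
abbrev BoolFamily : Type := (n : ℕ) → (Fin n → ZMod 2) → ZMod 2

/-- `Mod_{p,j}`: the value is `0` if the Hamming weight is congruent to `j` modulo `p`, and `1`
otherwise. -/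
def modFn (p j : ℕ) : BoolFamily := fun _ x =>
  if hammingNorm x ≡ j [MOD p] then 0 else 1

namespace QCircuit

/-- Classical bits: the `n` input bits and `M` work bits. -/
abbrev CBit (n M : ℕ) : Type := Fin n ⊕ Fin M

/-- Wires: `N` qubits and the classical bits. -/
abbrev Wire (n N M : ℕ) : Type := Fin N ⊕ CBit n M

/-- Elementary operations of a hybrid circuit. The input bits are never overwritten. -/
inductive Op (n N M : ℕ) : Type
  /-- A unitary on the `k` qubits `q 0, …, q (k-1)`, chosen by the values of the `l` classical
  bits `c 0, …, c (l-1)`. -/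
  | gate (k l : ℕ) (q : Fin k ↪ Fin N) (c : Fin l → CBit n M)
      (U : (Fin l → ZMod 2) → Matrix.unitaryGroup (Fin k → ZMod 2) ℂ)
  /-- Measurement of the qubit `q` in the computational basis; the outcome is stored in the work
  bit `t`. -/
  | measure (q : Fin N) (t : Fin M)
  /-- A call of the classical oracle on the bits `s 0, …, s (m-1)`; the answer is stored in the
  work bit `t`. -/
  | query (m : ℕ) (s : Fin m → CBit n M) (t : Fin M)

namespace Op

variable {n N M : ℕ}

/-- The number of wires entering a gate; oracle calls have unbounded fan-in and do not count. -/
def fanIn : Op n N M → ℕ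
  | gate k l _ _ _ => k + l
  | measure _ _ => 1
  | query _ _ _ => 0

/-- The size of the description of an operation: the number of its wires, plus one for a gate. -/
def size : Op n N M → ℕ
  | gate k l _ _ _ => k + l + 1
  | measure _ _ => 2
  | query m _ _ => m + 1

/-- The wires that no other operation of the same layer may use. -/
def exclusive : Op n N M → Set (Wire n N M)
  | gate _ _ q c _ => Set.range (fun i => Sum.inl (q i)) ∪ Set.range (fun i => Sum.inr (c i))
  | measure q t => {Sum.inl q, Sum.inr (Sum.inr t)}
  | query _ _ t => {Sum.inr (Sum.inr t)}

/-- The wires that may be shared, but only with other oracle calls that read them. -/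
def shared : Op n N M → Set (Wire n N M)
  | gate _ _ _ _ _ => ∅
  | measure _ _ => ∅
  | query _ s _ => Set.range (fun i => Sum.inr (s i))

/-- Two operations can be carried out in the same layer. -/
def Parallel (a b : Op n N M) : Prop :=
  Disjoint a.exclusive b.exclusive ∧ Disjoint a.exclusive b.shared ∧
    Disjoint a.shared b.exclusive

end Op

/-- A branch of the computation: the values of the classical bits and the unnormalized state
vector of the qubits, whose squared norm is the probability of the branch. -/
abbrev Branch (n N M : ℕ) : Type := (CBit n M → ZMod 2) × ((Fin N → ZMod 2) → ℂ)

/-- The branches into which an operation turns a branch, with `g` as the oracle. The vector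
`Function.extend q w z` is `z` with its entries at the qubits `q` replaced by `w`. -/
noncomputable def Op.step {n N M : ℕ} (g : BoolFamily) :
    Op n N M → Branch n N M → List (Branch n N M)
  | .gate k _ q c U, (a, ψ) =>
      [(a, fun z => ∑ w : Fin k → ZMod 2,
        (U (a ∘ c) : Matrix (Fin k → ZMod 2) (Fin k → ZMod 2) ℂ) (z ∘ q) w *
          ψ (Function.extend q w z))]
  | .measure q t, (a, ψ) =>
      [(Function.update a (Sum.inr t) 0, fun z => if z q = 0 then ψ z else 0),
       (Function.update a (Sum.inr t) 1, fun z => if z q = 1 then ψ z else 0)]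
  | .query m s t, (a, ψ) =>
      [(Function.update a (Sum.inr t) (g m (a ∘ s)), ψ)]

end QCircuit

/-- A layered circuit on `n` input bits, with `qubits` qubits and `bits` classical work bits, with
gates, measurements and classical oracle calls, and a designated classical output bit. -/
structure QCircuit (n : ℕ) : Type where
  qubits : ℕ
  bits : ℕ
  layers : List (List (QCircuit.Op n qubits bits))
  out : QCircuit.CBit n bits
  parallel : ∀ L ∈ layers, L.Pairwise QCircuit.Op.Parallel

namespace QCircuit

variable {n : ℕ}

/-- The number of layers: gate layers, measurement layers and rounds of oracle calls all count. -/
def depth (C : QCircuit n) : ℕ := C.layers.length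

/-- The number of wires plus the total size of all operations. -/
def size (C : QCircuit n) : ℕ :=
  n + C.qubits + C.bits + (C.layers.flatten.map Op.size).sum

/-- Every gate has fan-in at most `b`. -/
def FanInLE (C : QCircuit n) (b : ℕ) : Prop := ∀ L ∈ C.layers, ∀ o ∈ L, o.fanIn ≤ b

/-- Input `x` in the input bits, all work bits `0`, all qubits in the state `|0⟩`. -/
noncomputable def init (C : QCircuit n) (x : Fin n → ZMod 2) : Branch n C.qubits C.bits :=
  (Sum.elim x 0, Pi.single 0 1)

/-- All branches at the end of the computation on input `x` with oracle `g`. The order of the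
operations within a layer does not matter, because they are pairwise parallel. -/
noncomputable def run (C : QCircuit n) (g : BoolFamily) (x : Fin n → ZMod 2) :
    List (Branch n C.qubits C.bits) :=
  C.layers.flatten.foldl (fun bs o => bs.flatMap (o.step g)) [C.init x]

/-- The probability that the output bit is `y` on input `x`. -/
noncomputable def prob (C : QCircuit n) (g : BoolFamily) (x : Fin n → ZMod 2) (y : ZMod 2) : ℝ :=
  ((C.run g x).map fun b => if b.1 C.out = y then ∑ z, ‖b.2 z‖ ^ 2 else 0).sum

/-- The circuit with oracle `g` computes `f`: on every input the output is correct with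
probability one. -/
def Computes (C : QCircuit n) (g : BoolFamily) (f : (Fin n → ZMod 2) → ZMod 2) : Prop :=
  ∀ x, C.prob g x (f x) = 1

end QCircuit

/-- `f` is `QNC⁰`-reducible to `g`: it is computed by a (nonuniform) family of circuits of bounded
fan-in, constant depth and polynomial size with oracle access to `g` at all input lengths. -/
def QNC0Reducible (f g : BoolFamily) : Prop :=
  ∃ (b d : ℕ) (P : Polynomial ℕ), ∀ n : ℕ, ∃ C : QCircuit n,
    C.FanInLE b ∧ C.depth ≤ d ∧ C.size ≤ P.eval n ∧ C.Computes g (f n)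

namespace QCircuit

/-! ### Conservation of total probability -/

section Norm

/-! The Hamming weight is computed in a phase. There are a unit vector `α` and a phase function `φ`
such that `α * φ ^ m` depends only on `m` modulo `p`, with orthonormal vectors for distinct
residues; one unitary then shows on a single qubit whether `p` divides `m`
(`exists_modular_phases`). So register 0 should collect one factor `φ` for each input bit that is
set.

To do this in constant depth, the basis states of register 0 are copied to `n` further registers,
and copy `i + 1` takes the phase controlled by bit `i`. The copies arise from entangled pairs joined
by links. Measuring the links fixes the differences of neighbouring registers, so each copy equals
register 0 up to a shift, a prefix sum of outcomes (`forall_add_eq_succ_iff`). The parity oracle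
supplies these sums, and the shift is undone inside the argument of `φ`. Hadamard transforms and
measurements then remove the copies, at the cost of a sign on register 0 given by the coordinatewise
parities of the outcomes; the oracle computes these too, and a diagonal gate removes the sign.

No probability is computed along the way. Every operation preserves total weight
(`sum_weight_step`), so it suffices that branches with a wrong output vanish
(`computes_of_forall_branch`). States therefore need to be known only up to a scalar, and Hoare
triples carry them through the layers. -/

lemma extend_comp_self {κ Q α : Type*} {q : κ → Q} (hq : Function.Injective q) (v : κ → α)
    (z : Q → α) : Function.extend q v z ∘ q = v :=
  funext fun k => hq.extend_apply v z k

/-- Overwriting a block of coordinates with arbitrary values reaches every vector equally often. -/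
lemma sum_sum_extend {κ Q : Type*} [Fintype κ] [Fintype Q] [DecidableEq κ] [DecidableEq Q]
    {q : κ → Q} (hq : Function.Injective q) (F : (Q → ZMod 2) → ℝ) :
    ∑ z : Q → ZMod 2, ∑ v : κ → ZMod 2, F (Function.extend q v z) =
      Fintype.card (κ → ZMod 2) * ∑ z, F z := by
  have key : ∀ (z : Q → ZMod 2) (v : κ → ZMod 2),
      Function.extend q (z ∘ q) (Function.extend q v z) = z := by
    intro z v
    funext y
    by_cases hy : ∃ k, q k = y
    · obtain ⟨k, rfl⟩ := hy
      rw [hq.extend_apply]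
      rfl
    · rw [Function.extend_apply' _ _ _ hy, Function.extend_apply' _ _ _ hy]
  -- Exchanging `v` with the block of `z` at `q` is an involution on pairs; after this change of
  -- variables the summand no longer involves `v`.
  let e : (Q → ZMod 2) × (κ → ZMod 2) ≃ (Q → ZMod 2) × (κ → ZMod 2) :=
    Function.Involutive.toPerm (fun zv => (Function.extend q zv.2 zv.1, zv.1 ∘ q)) (by
      rintro ⟨z, v⟩
      simp only [key, Prod.mk.injEq, true_and]
      exact extend_comp_self hq v z)
  rw [← Fintype.sum_prod_type' (f := fun z v => F (Function.extend q v z)),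
    Fintype.sum_equiv e (fun zv => F (Function.extend q zv.2 zv.1)) (fun zv => F zv.1)
      (fun _ => rfl), Fintype.sum_prod_type]
  simp [Finset.mul_sum]

lemma extend_extend {κ Q α : Type*} {q : κ → Q} (hq : Function.Injective q) (w v : κ → α)
    (z : Q → α) : Function.extend q w (Function.extend q v z) = Function.extend q w z := by
  funext y
  by_cases hy : ∃ k, q k = y
  · obtain ⟨k, rfl⟩ := hy
    rw [hq.extend_apply, hq.extend_apply]
  · rw [Function.extend_apply' _ _ _ hy, Function.extend_apply' _ _ _ hy,
      Function.extend_apply' _ _ _ hy]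

lemma sum_norm_sq_unitary_mulVec {κ : Type*} [Fintype κ] [DecidableEq κ]
    (U : Matrix.unitaryGroup κ ℂ) (f : κ → ℂ) :
    ∑ v, ‖∑ w, (U : Matrix κ κ ℂ) v w * f w‖ ^ 2 = ∑ v, ‖f v‖ ^ 2 := by
  have h : ∀ f : κ → ℂ, ((∑ v, ‖f v‖ ^ 2 : ℝ) : ℂ) = star f ⬝ᵥ f := by
    intro f
    simp only [dotProduct, Pi.star_apply, RCLike.star_def, Complex.conj_mul']
    push_cast
    rfl
  have h2 : star ((U : Matrix κ κ ℂ).mulVec f) ⬝ᵥ (U : Matrix κ κ ℂ).mulVec f = star f ⬝ᵥ f := by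
    rw [Matrix.star_mulVec, Matrix.dotProduct_mulVec, Matrix.vecMul_vecMul,
      ← Matrix.star_eq_conjTranspose, Matrix.UnitaryGroup.star_mul_self, Matrix.vecMul_one]
  rw [← h, ← h] at h2
  exact_mod_cast h2

/-- The probability of a branch. -/
noncomputable def weight {n N M : ℕ} (b : Branch n N M) : ℝ := ∑ z, ‖b.2 z‖ ^ 2

/-- A gate is unitary on each fibre where the other qubits are fixed, a measurement cuts the vector
into two pieces with disjoint supports, and an oracle call leaves the vector alone. -/
lemma sum_weight_step {n N M : ℕ} (g : BoolFamily) (o : Op n N M) (b : Branch n N M) :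
    ((o.step g b).map weight).sum = weight b := by
  obtain ⟨a, ψ⟩ := b
  cases o with
  | gate k l q c U =>
    simp only [Op.step, List.map_cons, List.map_nil, List.sum_cons, List.sum_nil, add_zero, weight]
    have hpos : (Fintype.card (Fin k → ZMod 2) : ℝ) ≠ 0 := by
      exact_mod_cast Fintype.card_ne_zero
    -- The factor turns both sides into sums over all ways of overwriting the block, so that norm
    -- preservation applies for each `z` separately.
    apply mul_left_cancel₀ hpos
    rw [← sum_sum_extend q.injective, ← sum_sum_extend q.injective]
    refine Finset.sum_congr rfl fun z _ => ?_
    rw [← sum_norm_sq_unitary_mulVec (U (a ∘ c)) fun v => ψ (Function.extend q v z)]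
    refine Finset.sum_congr rfl fun v _ => ?_
    simp only [extend_comp_self q.injective]
    simp only [extend_extend q.injective]
  | measure q t =>
    simp only [Op.step, List.map_cons, List.map_nil, List.sum_cons, List.sum_nil, add_zero, weight]
    rw [← Finset.sum_add_distrib]
    refine Finset.sum_congr rfl fun z _ => ?_
    obtain h | h : z q = 0 ∨ z q = 1 := by
      generalize z q = u
      revert u
      decide
    · simp [h]
    · simp [h]
  | query m s t => simp [Op.step, weight]

lemma sum_weight_foldl {n N M : ℕ} (g : BoolFamily) (l : List (Op n N M))
    (bs : List (Branch n N M)) :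
    ((l.foldl (fun bs o => bs.flatMap (o.step g)) bs).map weight).sum = (bs.map weight).sum := by
  induction l generalizing bs with
  | nil => rfl
  | cons o l ih =>
    rw [List.foldl_cons, ih]
    induction bs with
    | nil => rfl
    | cons b bs ihb => simp [List.flatMap_cons, sum_weight_step, ihb]

/-- A circuit is correct if every branch with a wrong output has amplitude zero. -/
lemma computes_of_forall_branch {n : ℕ} (C : QCircuit n) (g : BoolFamily)
    (f : (Fin n → ZMod 2) → ZMod 2)
    (h : ∀ x, ∀ b ∈ C.run g x, b.1 C.out ≠ f x → b.2 = 0) : C.Computes g f := by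
  intro x
  have h1 : ((C.run g x).map weight).sum = 1 := by
    rw [run, sum_weight_foldl]
    simp only [List.map_cons, List.map_nil, List.sum_cons, List.sum_nil, add_zero, weight, init]
    rw [Finset.sum_eq_single 0]
    · simp
    · intro z _ hz
      simp [Pi.single_eq_of_ne hz]
    · simp
  rw [prob, ← h1]
  congr 1
  refine List.map_congr_left fun b hb => ?_
  split_ifs with hy
  · rfl
  · simp [weight, h x b hb hy]

end Norm

/-! ### Hoare triples for circuits with named wires -/

section Named

variable {n : ℕ} {Q K : Type} [Fintype Q] [Fintype K]

/-- Classical bits with named work bits, as bits of a circuit. -/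
noncomputable def cbit (n : ℕ) (K : Type) [Fintype K] : Fin n ⊕ K ≃ CBit n (Fintype.card K) :=
  Equiv.sumCongr (Equiv.refl _) (Fintype.equivFin K)

/-- Predicates on branches, in terms of named wires. -/
abbrev BPred (n : ℕ) (Q K : Type) : Type :=
  (Fin n ⊕ K → ZMod 2) → ((Q → ZMod 2) → ℂ) → Prop

/-- A predicate in terms of named wires holds for a branch of a circuit. -/
def Holds (P : BPred n Q K) (b : Branch n (Fintype.card Q) (Fintype.card K)) : Prop :=
  P (b.1 ∘ cbit n K) fun z => b.2 (z ∘ (Fintype.equivFin Q).symm)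

/-- Hoare triples: the operations `l` turn branches satisfying `P` into branches satisfying `R`. -/
def Triple (g : BoolFamily) (P : BPred n Q K)
    (l : List (Op n (Fintype.card Q) (Fintype.card K))) (R : BPred n Q K) : Prop :=
  ∀ bs : List (Branch n (Fintype.card Q) (Fintype.card K)), (∀ b ∈ bs, Holds P b) →
    ∀ b ∈ l.foldl (fun bs o => bs.flatMap (o.step g)) bs, Holds R b

variable {g : BoolFamily} {P R S : BPred n Q K}

lemma Triple.append {l l' : List (Op n (Fintype.card Q) (Fintype.card K))}
    (h : Triple g P l R) (h' : Triple g R l' S) : Triple g P (l ++ l') S := by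
  intro bs hbs
  rw [List.foldl_append]
  exact h' _ (h bs hbs)

lemma Triple.nil (g : BoolFamily) (P : BPred n Q K) : Triple g P [] P :=
  fun _ hbs => hbs

lemma Triple.consequence {l : List (Op n (Fintype.card Q) (Fintype.card K))} {R' : BPred n Q K}
    (h : Triple g P l R) (hR : ∀ a ψ, R a ψ → R' a ψ) : Triple g P l R' :=
  fun bs hbs b hb => hR _ _ (h bs hbs b hb)

lemma Triple.of_step {o : Op n (Fintype.card Q) (Fintype.card K)}
    (h : ∀ b, Holds P b → ∀ b' ∈ o.step g b, Holds R b') : Triple g P [o] R := by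
  intro bs hbs b hb
  simp only [List.foldl_cons, List.foldl_nil, List.mem_flatMap] at hb
  obtain ⟨b₀, hb₀, hb⟩ := hb
  exact h b₀ (hbs b₀ hb₀) b hb

/-- A layer with one operation for each element of `ι`. -/
noncomputable def layer {ι : Type} [Fintype ι] {N M : ℕ} (op : ι → Op n N M) : List (Op n N M) :=
  Finset.univ.toList.map op

/-- The list of a layer has an unspecified order, so the invariant is indexed by the set of
operations already carried out. -/
lemma Triple.of_layer {ι : Type} [Fintype ι] [DecidableEq ι]
    {op : ι → Op n (Fintype.card Q) (Fintype.card K)}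
    (I : Finset ι → BPred n Q K) (h : ∀ s, ∀ i ∉ s, Triple g (I s) [op i] (I (insert i s))) :
    Triple g (I ∅) (layer op) (I Finset.univ) := by
  have main : ∀ (l : List ι) (s : Finset ι), l.Nodup → (∀ i ∈ l, i ∉ s) →
      Triple g (I s) (l.map op) (I (s ∪ l.toFinset)) := by
    intro l
    induction l with
    | nil =>
      intro s _ _ bs hbs
      simpa using hbs
    | cons i l ih =>
      intro s hl hs
      rw [List.nodup_cons] at hl
      have h1 := h s i (hs i (by simp))
      have h2 := ih (insert i s) hl.2 (by
        intro j hj hjs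
        rcases Finset.mem_insert.1 hjs with rfl | hjs
        · exact hl.1 hj
        · exact hs j (by simp [hj]) hjs)
      have h3 := h1.append h2
      have e : insert i s ∪ l.toFinset = s ∪ (i :: l).toFinset := by
        ext; simp only [Finset.mem_union, Finset.mem_insert, List.toFinset_cons]; tauto
      rw [e] at h3
      exact h3
  have := main Finset.univ.toList ∅ (Finset.nodup_toList _) (by simp)
  simpa [QCircuit.layer] using this

lemma pairwise_layer {ι : Type} [Fintype ι] {N M : ℕ} {op : ι → Op n N M}
    (h : ∀ i j, i ≠ j → (op i).Parallel (op j)) : (layer op).Pairwise Op.Parallel := by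
  rw [layer, List.pairwise_map]
  exact (Finset.nodup_toList _).imp fun hij => h _ _ hij

lemma sum_size_layer_le {ι : Type} [Fintype ι] {N M : ℕ} {op : ι → Op n N M} {c : ℕ}
    (h : ∀ i, (op i).size ≤ c) : ((layer op).map Op.size).sum ≤ Fintype.card ι * c := by
  have := List.sum_le_card_nsmul ((layer op).map Op.size) c (by
    simpa [layer] using h)
  simpa [layer] using this

/-- A unitary with its index set renamed. -/
def reindexUnitary {α β : Type*} [Fintype α] [Fintype β] [DecidableEq α] [DecidableEq β]
    (e : β ≃ α) (U : Matrix.unitaryGroup α ℂ) : Matrix.unitaryGroup β ℂ :=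
  ⟨(U : Matrix α α ℂ).submatrix e e, by
    rw [Matrix.mem_unitaryGroup_iff, Matrix.star_eq_conjTranspose, Matrix.conjTranspose_submatrix,
      Matrix.submatrix_mul_equiv, ← Matrix.star_eq_conjTranspose,
      Matrix.mem_unitaryGroup_iff.1 U.2, Matrix.submatrix_one_equiv]⟩

/-! ### Gate layers -/

section Gate

variable {κ l : Type} [Fintype κ] [Fintype l] [DecidableEq κ]

/-- A gate on named wires. -/
noncomputable def gateOp (q : κ ↪ Q) (c : l → Fin n ⊕ K)
    (U : (l → ZMod 2) → Matrix.unitaryGroup (κ → ZMod 2) ℂ) :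
    Op n (Fintype.card Q) (Fintype.card K) :=
  .gate (Fintype.card κ) (Fintype.card l)
    ((Fintype.equivFin κ).symm.toEmbedding.trans (q.trans (Fintype.equivFin Q).toEmbedding))
    (cbit n K ∘ c ∘ (Fintype.equivFin l).symm)
    fun y => reindexUnitary ((Fintype.equivFin κ).symm.arrowCongr (Equiv.refl _))
      (U (y ∘ Fintype.equivFin l))

lemma Triple.gate {q : κ ↪ Q} {c : l → Fin n ⊕ K}
    {U : (l → ZMod 2) → Matrix.unitaryGroup (κ → ZMod 2) ℂ}
    (h : ∀ a ψ, P a ψ → R a fun z => ∑ w,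
      (U (a ∘ c) : Matrix (κ → ZMod 2) (κ → ZMod 2) ℂ) (z ∘ q) w * ψ (Function.extend q w z)) :
    Triple g P [gateOp q c U] R := by
  refine Triple.of_step fun b hb b' hb' => ?_
  obtain ⟨a, ψ⟩ := b
  simp only [gateOp, Op.step, List.mem_singleton] at hb'
  subst hb'
  refine (congrArg₂ R rfl ?_).mpr (h _ _ hb)
  funext z
  refine Fintype.sum_equiv ((Fintype.equivFin κ).symm.arrowCongr (Equiv.refl _)) _ _ fun w => ?_
  have h1 : (a ∘ ⇑(cbit n K) ∘ c ∘ ⇑(Fintype.equivFin l).symm) ∘ ⇑(Fintype.equivFin l) =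
      (a ∘ ⇑(cbit n K)) ∘ c := by
    funext i; simp
  rw [h1]
  have hext : Function.extend
      ((Fintype.equivFin κ).symm.toEmbedding.trans (q.trans (Fintype.equivFin Q).toEmbedding)) w
        (z ∘ (Fintype.equivFin Q).symm) =
      Function.extend q (w ∘ Fintype.equivFin κ) z ∘ (Fintype.equivFin Q).symm := by
    funext y
    obtain ⟨y, rfl⟩ := (Fintype.equivFin Q).surjective y
    by_cases hy : ∃ k, q k = y
    · obtain ⟨k, rfl⟩ := hy
      have := (((Fintype.equivFin κ).symm.toEmbedding.trans
        (q.trans (Fintype.equivFin Q).toEmbedding))).injective.extend_apply w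
          (z ∘ (Fintype.equivFin Q).symm) (Fintype.equivFin κ k)
      simp only [Function.Embedding.trans_apply, Equiv.coe_toEmbedding,
        Equiv.symm_apply_apply] at this
      rw [this]
      simp [q.injective.extend_apply]
    · rw [Function.extend_apply']
      · simp [Function.extend_apply' _ _ _ hy]
      · rintro ⟨k, hk⟩
        exact hy ⟨_, (Fintype.equivFin Q).injective hk⟩
  rw [hext]
  have h2 : ((z ∘ ⇑(Fintype.equivFin Q).symm) ∘
      ((Fintype.equivFin κ).symm.toEmbedding.trans (q.trans (Fintype.equivFin Q).toEmbedding))) ∘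
        (Fintype.equivFin κ) = z ∘ q := by
    funext k; simp
  rw [← h2]
  rfl

lemma parallel_gate {κ' l' : Type} [Fintype κ'] [Fintype l'] [DecidableEq κ']
    {q : κ ↪ Q} {c : l → Fin n ⊕ K} {U : (l → ZMod 2) → Matrix.unitaryGroup (κ → ZMod 2) ℂ}
    {q' : κ' ↪ Q} {c' : l' → Fin n ⊕ K}
    {U' : (l' → ZMod 2) → Matrix.unitaryGroup (κ' → ZMod 2) ℂ}
    (hq : ∀ k k', q k ≠ q' k') (hc : ∀ i i', c i ≠ c' i') :
    (gateOp q c U).Parallel (gateOp q' c' U') := by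
  refine ⟨?_, by simp [gateOp, Op.shared], by simp [gateOp, Op.shared]⟩
  rw [Set.disjoint_left]
  rintro _ (⟨k, rfl⟩ | ⟨i, rfl⟩) (⟨k', h⟩ | ⟨i', h⟩)
  · exact hq _ _ ((Fintype.equivFin Q).injective (Sum.inl_injective h)).symm
  · exact Sum.inr_ne_inl h
  · exact Sum.inl_ne_inr h
  · exact hc _ _ ((cbit n K).injective (Sum.inr_injective h)).symm

/-- Gates on disjoint registers act factor by factor on a state that is a product over these
registers, with coefficients depending on the remaining qubits. -/
lemma Triple.gateLayer {ι : Type} [Fintype ι] [DecidableEq ι] {q : ι → κ ↪ Q}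
    (hq : ∀ i j k k', q i k = q j k' → i = j) {c : ι → l → Fin n ⊕ K}
    {U : ι → (l → ZMod 2) → Matrix.unitaryGroup (κ → ZMod 2) ℂ}
    (h : ∀ a ψ, P a ψ → ∃ (A : (Q → ZMod 2) → ℂ) (f : ι → (Q → ZMod 2) → (κ → ZMod 2) → ℂ),
      (∀ z, ψ z = A z * ∏ i, f i z (z ∘ q i)) ∧
      (∀ i w z, A (Function.extend (q i) w z) = A z) ∧
      (∀ j i w z, f j (Function.extend (q i) w z) = f j z) ∧
      R a fun z => A z * ∏ i, ∑ w,
        (U i (a ∘ c i) : Matrix (κ → ZMod 2) (κ → ZMod 2) ℂ) (z ∘ q i) w * f i z w) :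
    Triple g P (layer fun i => gateOp (q i) (c i) (U i)) R := by
  -- The factors in `s` are already transformed. Overwriting a gate register changes neither `A` nor
  -- any `f j`, so each gate meets only its own factor.
  let I : Finset ι → BPred n Q K := fun s a ψ =>
    ∃ (A : (Q → ZMod 2) → ℂ) (f : ι → (Q → ZMod 2) → (κ → ZMod 2) → ℂ),
      (∀ z, ψ z = A z * ∏ i, if i ∈ s then ∑ w,
        (U i (a ∘ c i) : Matrix (κ → ZMod 2) (κ → ZMod 2) ℂ) (z ∘ q i) w * f i z w
        else f i z (z ∘ q i)) ∧
      (∀ i w z, A (Function.extend (q i) w z) = A z) ∧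
      (∀ j i w z, f j (Function.extend (q i) w z) = f j z) ∧
      R a fun z => A z * ∏ i, ∑ w,
        (U i (a ∘ c i) : Matrix (κ → ZMod 2) (κ → ZMod 2) ℂ) (z ∘ q i) w * f i z w
  have key : Triple g (I ∅) (layer fun i => gateOp (q i) (c i) (U i)) (I Finset.univ) := by
    refine Triple.of_layer I fun s i hi => Triple.gate ?_
    rintro a ψ ⟨A, f, hψ, hA, hf, hR⟩
    refine ⟨A, f, fun z => ?_, hA, hf, hR⟩
    have hcomp : ∀ w, Function.extend (q i) w z ∘ q i = w := fun w =>
      extend_comp_self (q i).injective w z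
    have hcomp' : ∀ w, ∀ j ≠ i, Function.extend (q i) w z ∘ q j = z ∘ q j := by
      intro w j hj
      funext k
      exact Function.extend_apply' _ _ _ fun ⟨k', hk'⟩ => hj (hq _ _ _ _ hk').symm
    rw [← Finset.mul_prod_erase _ _ (Finset.mem_univ i), if_pos (Finset.mem_insert_self i s),
      Finset.sum_mul, Finset.mul_sum]
    refine Finset.sum_congr rfl fun w _ => ?_
    rw [hψ, ← Finset.mul_prod_erase _ _ (Finset.mem_univ i), if_neg hi, hA, hcomp, hf]
    have : ∏ x ∈ Finset.univ.erase i, (if x ∈ s then ∑ w',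
          (U x (a ∘ c x) : Matrix (κ → ZMod 2) (κ → ZMod 2) ℂ)
            (Function.extend (q i) w z ∘ q x) w' * f x (Function.extend (q i) w z) w'
          else f x (Function.extend (q i) w z) (Function.extend (q i) w z ∘ q x)) =
        ∏ x ∈ Finset.univ.erase i, (if x ∈ insert i s then ∑ w',
          (U x (a ∘ c x) : Matrix (κ → ZMod 2) (κ → ZMod 2) ℂ) (z ∘ q x) w' * f x z w'
          else f x z (z ∘ q x)) := by
      refine Finset.prod_congr rfl fun x hx => ?_
      have hxi := Finset.ne_of_mem_erase hx
      rw [hcomp' w x hxi, hf]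
      simp [hxi]
    rw [this]
    ring
  intro bs hbs
  refine (key.consequence ?_) bs fun b hb => ?_
  · rintro a ψ ⟨A, f, hψ, -, -, hR⟩
    have : ψ = fun z => A z * ∏ i, ∑ w,
        (U i (a ∘ c i) : Matrix (κ → ZMod 2) (κ → ZMod 2) ℂ) (z ∘ q i) w * f i z w := by
      funext z
      rw [hψ]
      simp
    rw [this]
    exact hR
  · obtain ⟨A, f, hψ, hA, hf, hR⟩ := h _ _ (hbs b hb)
    exact ⟨A, f, fun z => (hψ z).trans (by simp), hA, hf, hR⟩

end Gate

/-! ### Measurement layers -/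

section Measure

/-- A measurement on named wires. -/
noncomputable def measureOp (n : ℕ) (q : Q) (t : K) : Op n (Fintype.card Q) (Fintype.card K) :=
  .measure (Fintype.equivFin Q q) (Fintype.equivFin K t)

lemma parallel_measure {q q' : Q} {t t' : K} (hq : q ≠ q') (ht : t ≠ t') :
    (measureOp n q t).Parallel (measureOp n q' t') := by
  refine ⟨?_, by simp [measureOp, Op.shared], by simp [measureOp, Op.shared]⟩
  simp [measureOp, Op.exclusive, hq.symm, ht.symm]

variable [DecidableEq K]

lemma update_comp_cbit (a : CBit n (Fintype.card K) → ZMod 2) (t : K) (u : ZMod 2) :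
    Function.update a (Sum.inr (Fintype.equivFin K t)) u ∘ cbit n K =
      Function.update (a ∘ cbit n K) (Sum.inr t) u := by
  have : (Sum.inr (Fintype.equivFin K t) : CBit n (Fintype.card K)) = cbit n K (Sum.inr t) := rfl
  rw [this, Function.update_comp_eq_of_injective _ (cbit n K).injective]

lemma Triple.measure {q : Q} {t : K}
    (h : ∀ a ψ u, P a ψ → R (Function.update a (Sum.inr t) u) fun z =>
      if z q = u then ψ z else 0) :
    Triple g P [measureOp n q t] R := by
  refine Triple.of_step fun b hb b' hb' => ?_
  obtain ⟨a, ψ⟩ := b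
  simp only [measureOp, Op.step, List.mem_cons, List.not_mem_nil, or_false] at hb'
  rcases hb' with rfl | rfl
  · have := h _ _ 0 hb
    simpa [Holds, update_comp_cbit] using this
  · have := h _ _ 1 hb
    simpa [Holds, update_comp_cbit] using this

/-- The outcomes stay arbitrary: `a` may differ from `a₀` at the targets, and only the projection
ties the vector to it. Injectivity of `t` keeps each outcome from being overwritten. -/
lemma Triple.measureLayer {ι : Type} [Fintype ι] [DecidableEq ι] {q : ι → Q} {t : ι → K}
    (ht : Function.Injective t)
    (h : ∀ a₀ ψ a, P a₀ ψ → (∀ c, (∀ i, c ≠ Sum.inr (t i)) → a c = a₀ c) →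
      R a fun z => if ∀ i, z (q i) = a (Sum.inr (t i)) then ψ z else 0) :
    Triple g P (layer fun i => measureOp n (q i) (t i)) R := by
  let I : Finset ι → BPred n Q K := fun s a ψ => ∃ a₀ ψ₀, P a₀ ψ₀ ∧
    (∀ c, (∀ i ∈ s, c ≠ Sum.inr (t i)) → a c = a₀ c) ∧
    ψ = fun z => if ∀ i ∈ s, z (q i) = a (Sum.inr (t i)) then ψ₀ z else 0
  have key : Triple g (I ∅) (layer fun i => measureOp n (q i) (t i)) (I Finset.univ) := by
    refine Triple.of_layer I fun s i hi => Triple.measure ?_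
    rintro a _ u ⟨a₀, ψ₀, hP, ha, rfl⟩
    refine ⟨a₀, ψ₀, hP, fun c hc => ?_, ?_⟩
    · rw [Function.update_of_ne (hc i (by simp)), ha c fun j hj => hc j (by simp [hj])]
    · funext z
      have hne : ∀ j ∈ s, Function.update a (Sum.inr (t i)) u (Sum.inr (t j)) =
          a (Sum.inr (t j)) := by
        intro j hj
        apply Function.update_of_ne
        intro e
        exact hi (ht (Sum.inr_injective e) ▸ hj)
      have : (∀ j ∈ insert i s, z (q j) = Function.update a (Sum.inr (t i)) u (Sum.inr (t j))) ↔
          z (q i) = u ∧ ∀ j ∈ s, z (q j) = a (Sum.inr (t j)) := by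
        rw [Finset.forall_mem_insert, Function.update_self]
        refine and_congr_right fun _ => forall₂_congr fun j hj => ?_
        rw [hne j hj]
      simp only [this, ite_and]
  intro bs hbs
  refine (key.consequence ?_) bs fun b hb => ⟨_, _, hbs b hb, by simp, by simp⟩
  rintro a _ ⟨a₀, ψ₀, hP, ha, rfl⟩
  simpa using h a₀ ψ₀ a hP (by simpa using ha)

end Measure

/-! ### Oracle layers -/

section Query

/-- A call of the oracle on named wires. -/
noncomputable def queryOp (Q : Type) [Fintype Q] {σ : Type} [Fintype σ] (s : σ → Fin n ⊕ K)
    (t : K) : Op n (Fintype.card Q) (Fintype.card K) :=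
  .query (Fintype.card σ) (cbit n K ∘ s ∘ (Fintype.equivFin σ).symm) (Fintype.equivFin K t)

/-- The oracle is parity, that is, addition in `ZMod 2`; nothing else about it is used. -/
lemma modFn_two_zero (m : ℕ) (y : Fin m → ZMod 2) : modFn 2 0 m y = ∑ i, y i := by
  have h : ∑ i, y i = (hammingNorm y : ZMod 2) := by
    rw [hammingNorm, Finset.card_eq_sum_ones, Finset.sum_filter]
    push_cast
    refine Finset.sum_congr rfl fun i _ => ?_
    generalize y i = u
    revert u
    decide
  rw [h, modFn]
  split_ifs with hm
  · rw [(ZMod.natCast_eq_natCast_iff _ _ _).2 hm]; simp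
  · have : (hammingNorm y : ZMod 2) ≠ 0 := by
      intro h0
      apply hm
      rw [← ZMod.natCast_eq_natCast_iff, h0]; simp
    revert this
    generalize (hammingNorm y : ZMod 2) = u
    revert u
    decide

lemma parallel_query {σ σ' : Type} [Fintype σ] [Fintype σ'] {s : σ → Fin n ⊕ K}
    {s' : σ' → Fin n ⊕ K} {t t' : K} (ht : t ≠ t') (h : ∀ j, s j ≠ Sum.inr t')
    (h' : ∀ j, s' j ≠ Sum.inr t) : (queryOp Q s t).Parallel (queryOp Q s' t') := by
  have e : ∀ t : K, (Sum.inr (Fintype.equivFin K t) : CBit n (Fintype.card K)) =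
    cbit n K (Sum.inr t) := fun _ => rfl
  refine ⟨?_, ?_, ?_⟩
  · simp [queryOp, Op.exclusive, ht]
  · simp [queryOp, Op.exclusive, Op.shared, e, h']
  · simp [queryOp, Op.exclusive, Op.shared, e, h]

variable [DecidableEq K]

lemma Triple.query {σ : Type} [Fintype σ] {s : σ → Fin n ⊕ K} {t : K}
    (h : ∀ a ψ, P a ψ → R (Function.update a (Sum.inr t) (∑ j, a (s j))) ψ) :
    Triple (modFn 2 0) P [queryOp Q s t] R := by
  refine Triple.of_step fun b hb b' hb' => ?_
  obtain ⟨a, ψ⟩ := b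
  simp only [queryOp, Op.step, List.mem_singleton] at hb'
  subst hb'
  have := h _ _ hb
  rw [Holds, update_comp_cbit, modFn_two_zero]
  convert this using 2
  exact Fintype.sum_equiv (Fintype.equivFin σ).symm _ _ fun j => rfl

/-- Because no call reads a target (`hs`), the answers can be expressed by the bits after the layer.
-/
lemma Triple.queryLayer {ι : Type} [Fintype ι] [DecidableEq ι] {σ : ι → Type}
    [∀ i, Fintype (σ i)] {s : ∀ i, σ i → Fin n ⊕ K} {t : ι → K}
    (ht : Function.Injective t) (hs : ∀ i j k, s i j ≠ Sum.inr (t k))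
    (h : ∀ a₀ ψ a, P a₀ ψ → (∀ c, (∀ i, c ≠ Sum.inr (t i)) → a c = a₀ c) →
      (∀ i, a (Sum.inr (t i)) = ∑ j, a (s i j)) → R a ψ) :
    Triple (modFn 2 0) P (layer fun i => queryOp Q (s i) (t i)) R := by
  let I : Finset ι → BPred n Q K := fun S a ψ => ∃ a₀, P a₀ ψ ∧
    (∀ c, (∀ i ∈ S, c ≠ Sum.inr (t i)) → a c = a₀ c) ∧
    ∀ i ∈ S, a (Sum.inr (t i)) = ∑ j, a (s i j)
  have key : Triple (modFn 2 0) (I ∅) (layer fun i => queryOp Q (s i) (t i)) (I Finset.univ) := by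
    refine Triple.of_layer I fun S i hi => Triple.query ?_
    rintro a ψ ⟨a₀, hP, ha, hS⟩
    have hs' : ∀ i' j u, Function.update a (Sum.inr (t i)) u (s i' j) = a (s i' j) :=
      fun i' j u => Function.update_of_ne (hs i' j i) _ _
    refine ⟨a₀, hP, fun c hc => ?_, fun k hk => ?_⟩
    · rw [Function.update_of_ne (hc i (by simp)), ha c fun j hj => hc j (by simp [hj])]
    · simp only [hs']
      rcases Finset.mem_insert.1 hk with rfl | hk
      · simp
      · rw [Function.update_of_ne, hS k hk]
        intro e
        exact hi (ht (Sum.inr_injective e) ▸ hk)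
  intro bs hbs
  refine (key.consequence ?_) bs fun b hb => ⟨_, hbs b hb, by simp, by simp⟩
  rintro a ψ ⟨a₀, hP, ha, hS⟩
  exact h a₀ ψ a hP (by simpa using ha) (by simpa using hS)

end Query

end Named

end QCircuit

namespace QCircuit

/-! ### Unitaries, characters and roots of unity -/

section Unitaries

/-- Finitely many orthonormal vectors are columns of a unitary, at prescribed positions. -/
lemma exists_unitary_columns {V J : Type*} [Fintype V] [DecidableEq V] [DecidableEq J]
    (e : J ↪ V) (u : J → V → ℂ) (hu : ∀ i j, ∑ w, star (u i w) * u j w = if i = j then 1 else 0) :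
    ∃ U : Matrix.unitaryGroup V ℂ, ∀ j w, (U : Matrix V V ℂ) w (e j) = u j w := by
  classical
  -- The default `0` is harmless: orthonormality is required only on the range of `e`, and the
  -- extension to a basis replaces the rest.
  let v : V → EuclideanSpace ℂ V := Function.extend e (fun j => WithLp.toLp 2 (u j)) 0
  have hv : ∀ j, v (e j) = WithLp.toLp 2 (u j) := fun j => e.injective.extend_apply _ _ j
  have horth : Orthonormal ℂ ((Set.range e).domRestrict v) := by
    rw [orthonormal_iff_ite]
    rintro ⟨_, i, rfl⟩ ⟨_, j, rfl⟩
    have hij : ((⟨e i, Set.mem_range_self i⟩ : Set.range e) = ⟨e j, Set.mem_range_self j⟩) ↔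
        i = j := by
      rw [Subtype.mk_eq_mk, e.injective.eq_iff]
    rw [if_congr hij rfl rfl, ← hu i j]
    simp only [Set.domRestrict_apply, hv, PiLp.inner_apply, RCLike.inner_apply]
    exact Finset.sum_congr rfl fun w _ => mul_comm _ _
  obtain ⟨b, hb⟩ := horth.exists_orthonormalBasis_extension_of_card_eq (by simp)
  refine ⟨⟨(EuclideanSpace.basisFun V ℂ).toBasis.toMatrix b,
    (EuclideanSpace.basisFun V ℂ).toMatrix_orthonormalBasis_mem_unitary b⟩, fun j w => ?_⟩
  have : b (e j) = WithLp.toLp 2 (u j) := by rw [hb _ ⟨j, rfl⟩, hv]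
  simp [Module.Basis.toMatrix_apply, this]

/-- Every nonzero vector is, up to a scalar, the first column of a unitary. -/
lemma exists_unitary_column {V : Type*} [Fintype V] [DecidableEq V] (o : V) (u : V → ℂ)
    (hu : u ≠ 0) :
    ∃ (U : Matrix.unitaryGroup V ℂ) (c : ℂ), ∀ w, (U : Matrix V V ℂ) w o = c * u w := by
  set s : ℝ := ∑ w, ‖u w‖ ^ 2 with hs
  have hs0 : 0 < s := by
    obtain ⟨w, hw⟩ := Function.ne_iff.1 hu
    exact Finset.sum_pos' (fun _ _ => by positivity) ⟨w, Finset.mem_univ w, by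
      have : 0 < ‖u w‖ := norm_pos_iff.2 hw
      positivity⟩
  obtain ⟨U, hU⟩ := exists_unitary_columns (J := Unit) ⟨fun _ => o, fun _ _ _ => rfl⟩
    (fun _ w => ((Real.sqrt s)⁻¹ : ℝ) * u w) (by
      intro _ _
      have : ∀ w, star ((((Real.sqrt s)⁻¹ : ℝ) : ℂ) * u w) * ((((Real.sqrt s)⁻¹ : ℝ) : ℂ) * u w) =
          ((s⁻¹ * ‖u w‖ ^ 2 : ℝ) : ℂ) := by
        intro w
        rw [RCLike.star_def, Complex.conj_mul', norm_mul, ← Complex.ofReal_pow, mul_pow,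
          Complex.norm_real, Real.norm_eq_abs, sq_abs, inv_pow, Real.sq_sqrt hs0.le]
      simp only [this, ← Complex.ofReal_sum, ← Finset.mul_sum]
      rw [← hs, inv_mul_cancel₀ hs0.ne']
      simp)
  exact ⟨U, _, fun w => hU () w⟩

/-- The sign `(-1) ^ b`. -/
def sign : AddChar (ZMod 2) ℂ where
  toFun b := if b = 0 then 1 else -1
  map_zero_eq_one' := by simp
  map_add_eq_mul' := by
    intro a b
    have h : ∀ a : ZMod 2, a = 0 ∨ a = 1 := by decide
    have h2 : (1 + 1 : ZMod 2) = 0 := by decide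
    rcases h a with rfl | rfl <;> rcases h b with rfl | rfl <;> simp [h2]

lemma sign_apply (b : ZMod 2) : sign b = if b = 0 then 1 else -1 := rfl

lemma sign_mul_self (b : ZMod 2) : sign b * sign b = 1 := by
  rw [sign_apply]; split_ifs <;> simp

lemma star_sign (b : ZMod 2) : star (sign b) = sign b := by
  rw [sign_apply]; split_ifs <;> simp

/-- Orthogonality of characters: `w ↦ sign (v ⬝ᵥ w)` is trivial only for `v = 0`. -/
lemma sum_sign_dotProduct {r : ℕ} (v : Fin r → ZMod 2) :
    ∑ w : Fin r → ZMod 2, sign (v ⬝ᵥ w) = if v = 0 then 2 ^ r else 0 := by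
  classical
  let χ : AddChar (Fin r → ZMod 2) ℂ :=
    { toFun := fun w => sign (v ⬝ᵥ w)
      map_zero_eq_one' := by simp
      map_add_eq_mul' := fun w w' => by rw [dotProduct_add, AddChar.map_add_eq_mul] }
  have h := AddChar.sum_eq_ite χ
  have hχ : χ = 0 ↔ v = 0 := by
    constructor
    · intro h0
      funext k
      have h1 : sign (v ⬝ᵥ Pi.single k 1) = 1 := DFunLike.congr_fun h0 (Pi.single k 1)
      rw [dotProduct_single, mul_one, sign_apply] at h1
      by_contra hk
      rw [if_neg (show v k ≠ 0 from hk)] at h1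
      norm_num at h1
    · rintro rfl
      ext w
      change sign (0 ⬝ᵥ w) = 1
      simp
  rw [if_congr hχ rfl rfl] at h
  refine h.trans ?_
  simp

/-- The Hadamard transform on `r` qubits, with the normalizing scalar left unspecified. -/
lemma exists_hadamard (r : ℕ) : ∃ (h : ℂ) (H : Matrix.unitaryGroup (Fin r → ZMod 2) ℂ),
    ∀ v w, (H : Matrix (Fin r → ZMod 2) (Fin r → ZMod 2) ℂ) v w = h * sign (v ⬝ᵥ w) := by
  set h : ℝ := (Real.sqrt (2 ^ r))⁻¹ with hh
  have hsq : h * h = (2 ^ r)⁻¹ := by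
    rw [hh, ← mul_inv, Real.mul_self_sqrt (by positivity)]
  refine ⟨h, ⟨Matrix.of fun v w => (h : ℂ) * sign (v ⬝ᵥ w), ?_⟩, fun _ _ => rfl⟩
  rw [Matrix.mem_unitaryGroup_iff]
  ext u v
  simp only [Matrix.mul_apply, Matrix.star_apply, Matrix.of_apply, star_mul', star_sign,
    RCLike.star_def, Complex.conj_ofReal]
  have : ∀ w : Fin r → ZMod 2, (h : ℂ) * sign (u ⬝ᵥ w) * (h * sign (v ⬝ᵥ w)) =
      ((h * h : ℝ) : ℂ) * sign ((u + v) ⬝ᵥ w) := by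
    intro w
    rw [add_dotProduct, AddChar.map_add_eq_mul]
    push_cast
    ring
  simp only [this, ← Finset.mul_sum, sum_sign_dotProduct, hsq, Matrix.one_apply]
  have huv : u + v = 0 ↔ u = v := by
    simp only [funext_iff, Pi.add_apply, Pi.zero_apply, CharTwo.add_eq_zero]
  simp only [huv]
  split_ifs
  · push_cast
    exact inv_mul_cancel₀ (pow_ne_zero _ two_ne_zero)
  · simp

/-- The diagonal unitary with given entries. -/
def diagUnitary {V : Type*} [Fintype V] [DecidableEq V] (d : V → ℂ) (hd : ∀ v, d v * star (d v) = 1) :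
    Matrix.unitaryGroup V ℂ :=
  ⟨Matrix.diagonal d, by
    rw [Matrix.mem_unitaryGroup_iff, Matrix.star_eq_conjTranspose, Matrix.diagonal_conjTranspose,
      Matrix.diagonal_mul_diagonal]
    simp only [Pi.star_apply, hd]
    exact Matrix.diagonal_one⟩

lemma mul_diagUnitary_apply {V : Type*} [Fintype V] [DecidableEq V] (U : Matrix.unitaryGroup V ℂ)
    (d : V → ℂ) (hd : ∀ v, d v * star (d v) = 1) (v w : V) :
    ((U * diagUnitary d hd : Matrix.unitaryGroup V ℂ) : Matrix V V ℂ) v w =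
      (U : Matrix V V ℂ) v w * d w := by
  rw [Matrix.UnitaryGroup.mul_val, diagUnitary, Matrix.mul_diagonal]

/-- The permutation unitary that maps the vector `ψ` to `ψ ∘ π`. -/
def permUnitary {V : Type*} [Fintype V] [DecidableEq V] (π : Equiv.Perm V) :
    Matrix.unitaryGroup V ℂ :=
  ⟨(1 : Matrix V V ℂ).submatrix π id, by
    rw [Matrix.mem_unitaryGroup_iff, Matrix.star_eq_conjTranspose, Matrix.conjTranspose_submatrix,
      Matrix.conjTranspose_one]
    change (1 : Matrix V V ℂ).submatrix π (Equiv.refl V) *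
      (1 : Matrix V V ℂ).submatrix (Equiv.refl V) π = 1
    rw [Matrix.submatrix_mul_equiv, mul_one, Matrix.submatrix_one_equiv]⟩

lemma sum_permUnitary_mul {V : Type*} [Fintype V] [DecidableEq V] (π : Equiv.Perm V) (v : V)
    (f : V → ℂ) : ∑ w, (permUnitary π : Matrix V V ℂ) v w * f w = f (π v) := by
  simp [permUnitary, Matrix.one_apply]

/-- A geometric series whose ratio `ζ ^ (j - i)` is a `p`-th root of unity, equal to `1` only for `i
= j`. -/
lemma sum_star_pow_mul_pow {p : ℕ} {ζ : ℂ} (hζ : IsPrimitiveRoot ζ p) (i j : Fin p) :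
    ∑ k : Fin p, star (ζ ^ (k * i : ℕ)) * ζ ^ (k * j : ℕ) = if i = j then (p : ℂ) else 0 := by
  have hp : p ≠ 0 := by
    rintro rfl
    exact i.elim0
  have hnorm : ‖ζ‖ = 1 := hζ.norm'_eq_one hp
  have hζ0 : ζ ≠ 0 := hζ.ne_zero hp
  have hstar : star ζ = ζ⁻¹ := by
    rw [Complex.inv_def, Complex.normSq_eq_norm_sq, hnorm]
    simp
  set η : ℂ := (ζ ^ (i : ℕ))⁻¹ * ζ ^ (j : ℕ) with hη
  have hterm : ∀ k : Fin p, star (ζ ^ (k * i : ℕ)) * ζ ^ (k * j : ℕ) = η ^ (k : ℕ) := by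
    intro k
    rw [star_pow, hstar, hη, mul_pow, inv_pow, inv_pow, ← pow_mul, ← pow_mul, mul_comm (i : ℕ),
      mul_comm (j : ℕ)]
  simp only [hterm]
  rw [Fin.sum_univ_eq_sum_range (fun k => η ^ k) p]
  split_ifs with hij
  · have : η = 1 := by rw [hη, hij, inv_mul_cancel₀ (pow_ne_zero _ hζ0)]
    simp [this]
  · have h1 : η ≠ 1 := by
      intro h
      apply hij
      rw [hη, inv_mul_eq_one₀ (pow_ne_zero _ hζ0)] at h
      exact Fin.ext (hζ.pow_inj i.2 j.2 h)
    have h2 : η ^ p = 1 := by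
      rw [hη, mul_pow, inv_pow, ← pow_mul, ← pow_mul, mul_comm (i : ℕ), mul_comm (j : ℕ), pow_mul,
        pow_mul, hζ.pow_eq_one]
      simp
    rw [geom_sum_eq h1, h2]
    simp

/-- Phases `φ` on strings of `p` bits and a start vector `α` such that the vectors `α * φ ^ m` are
recognized, according to whether `p` divides `m`, by a measurement of one qubit. -/
lemma exists_modular_phases {p : ℕ} (hp : 0 < p) :
    ∃ (k₀ : Fin p) (φ α : (Fin p → ZMod 2) → ℂ) (U W : Matrix.unitaryGroup (Fin p → ZMod 2) ℂ),
      (∀ w, φ w * star (φ w) = 1) ∧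
      (∀ w, (U : Matrix (Fin p → ZMod 2) (Fin p → ZMod 2) ℂ) w 0 = α w) ∧
      ∀ (m : ℕ) (v : Fin p → ZMod 2), v k₀ ≠ (if m ≡ 0 [MOD p] then 0 else 1) →
        ∑ w, (W : Matrix (Fin p → ZMod 2) (Fin p → ZMod 2) ℂ) v w * (α w * φ w ^ m) = 0 := by
  classical
  set ζ : ℂ := Complex.exp (2 * Real.pi * Complex.I / p) with hζdef
  have hζ : IsPrimitiveRoot ζ p := Complex.isPrimitiveRoot_exp p hp.ne'
  have hnorm : ‖ζ‖ = 1 := hζ.norm'_eq_one hp.ne'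
  let k₀ : Fin p := ⟨0, hp⟩
  -- Numbers below `p` are encoded in unary, which is why a register has `p` qubits.
  let e : Fin p → Fin p → ZMod 2 := fun k => Pi.single k 1
  have he : Function.Injective e := fun k k' h => by
    by_contra hne
    have := congrFun h k
    simp [e, hne] at this
  let s : ℝ := (Real.sqrt p)⁻¹
  have hs : ((s : ℂ) * s) = (p : ℂ)⁻¹ := by
    rw [← Complex.ofReal_mul, ← mul_inv, Real.mul_self_sqrt (by positivity)]
    simp
  -- The Fourier basis of the span of the encoded numbers; `u k₀` is the uniform superposition.
  let u : Fin p → (Fin p → ZMod 2) → ℂ := fun m =>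
    Function.extend e (fun k => s * ζ ^ (k * m : ℕ)) 0
  have hu : ∀ m k, u m (e k) = s * ζ ^ (k * m : ℕ) := fun m k => he.extend_apply _ _ k
  have hu0 : ∀ m w, (¬ ∃ k, e k = w) → u m w = 0 := fun m w hw => Function.extend_apply' _ _ _ hw
  have hort : ∀ i j, ∑ w, star (u i w) * u j w = if i = j then 1 else 0 := by
    intro i j
    rw [← Finset.sum_subset (Finset.subset_univ (Finset.univ.map ⟨e, he⟩)), Finset.sum_map]
    · have hterm : ∀ k : Fin p, star (u i (e k)) * u j (e k) =
          (p : ℂ)⁻¹ * (star (ζ ^ (k * i : ℕ)) * ζ ^ (k * j : ℕ)) := by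
        intro k
        rw [hu, hu, star_mul', ← hs]
        simp only [RCLike.star_def, Complex.conj_ofReal]
        ring
      simp only [Function.Embedding.coeFn_mk, hterm, ← Finset.mul_sum, sum_star_pow_mul_pow hζ]
      split_ifs
      · exact inv_mul_cancel₀ (by exact_mod_cast hp.ne')
      · simp
    · intro w _ hw
      rw [hu0 j w (by simpa using hw), mul_zero]
  -- The label of the residue `m` has its only `0` at position `m`, so the bit at `k₀` is `0`
  -- exactly for residue zero.
  let c : Fin p ↪ (Fin p → ZMod 2) := ⟨fun m k => if k = m then 0 else 1, fun m m' h => by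
    by_contra hne
    have := congrFun h m
    simp [hne] at this⟩
  obtain ⟨U, hU⟩ := exists_unitary_columns (J := Unit) ⟨fun _ => 0, fun _ _ _ => rfl⟩
    (fun _ => u k₀) (fun _ _ => by simpa using hort k₀ k₀)
  obtain ⟨T, hT⟩ := exists_unitary_columns c u hort
  -- As a product over bits this has modulus one on all strings, also those that encode no number.
  let φ : (Fin p → ZMod 2) → ℂ := fun w => ∏ k, if w k = 0 then 1 else ζ ^ (k : ℕ)
  have hφ : ∀ k, φ (e k) = ζ ^ (k : ℕ) := by
    intro k
    change ∏ k', _ = _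
    rw [Finset.prod_eq_single k]
    · simp [e]
    · intro k' _ hk'
      simp [e, hk']
    · simp
  have hαφ : ∀ (m : ℕ) w, u k₀ w * φ w ^ m = u ⟨m % p, Nat.mod_lt _ hp⟩ w := by
    intro m w
    by_cases hw : ∃ k, e k = w
    · obtain ⟨k, rfl⟩ := hw
      rw [hu, hu, hφ]
      have : ζ ^ ((k : ℕ) * (m % p)) = ζ ^ ((k : ℕ) * m) := by
        have h1 : ζ ^ (m % p) = ζ ^ m := by
          conv_lhs => rw [hζ.eq_orderOf, pow_mod_orderOf]
        rw [mul_comm, pow_mul, h1, mul_comm (k : ℕ) m, pow_mul]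
      simp [k₀, this, pow_mul]
    · rw [hu0 _ _ hw, hu0 _ _ hw, zero_mul]
  refine ⟨k₀, φ, u k₀, U, star T, fun w => ?_, fun w => hU () w, fun m v hv => ?_⟩
  · rw [RCLike.star_def, Complex.mul_conj, Complex.normSq_eq_norm_sq]
    have : ‖φ w‖ = 1 := by
      change ‖∏ k, _‖ = 1
      rw [norm_prod]
      refine Finset.prod_eq_one fun k _ => ?_
      split_ifs <;> simp [hnorm]
    simp [this]
  -- The vector is the column of `T` at the label of `m % p`, and `star T` sends it back to that
  -- basis vector.
  · rw [Finset.sum_congr rfl fun w _ => by rw [hαφ, ← hT]]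
    have h1 := congrFun (congrFun (Matrix.UnitaryGroup.star_mul_self T) v)
      (c ⟨m % p, Nat.mod_lt _ hp⟩)
    rw [Matrix.mul_apply] at h1
    refine h1.trans (Matrix.one_apply_ne ?_)
    rintro rfl
    apply hv
    change (if k₀ = _ then (0 : ZMod 2) else 1) = _
    refine if_congr ?_ rfl rfl
    rw [Fin.ext_iff, Nat.ModEq, Nat.zero_mod]
    exact eq_comm

end Unitaries

end QCircuit

namespace QCircuit

/-! ### Wires and layers of the circuit -/

section ModCircuit

/-- The qubits: registers `0, …, n` and links `0, …, n - 1`, of `r` qubits each. -/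
abbrev Qubit (n r : ℕ) : Type := (Fin (n + 1) × Fin r) ⊕ (Fin n × Fin r)

/-- The work bits: outcomes for the links, shifts of the registers, outcomes for the registers,
the final correction, and the output. -/
abbrev WorkBit (n r : ℕ) : Type :=
  (Fin n × Fin r) ⊕ (Fin n × Fin r) ⊕ (Fin n × Fin r) ⊕ Fin r ⊕ Unit

variable {n r : ℕ}

abbrev reg (i : Fin (n + 1)) (k : Fin r) : Qubit n r := Sum.inl (i, k)

abbrev link (i : Fin n) (k : Fin r) : Qubit n r := Sum.inr (i, k)

abbrev linkBit (i : Fin n) (k : Fin r) : WorkBit n r := Sum.inl (i, k)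

abbrev shiftBit (i : Fin n) (k : Fin r) : WorkBit n r := Sum.inr (Sum.inl (i, k))

abbrev regBit (i : Fin n) (k : Fin r) : WorkBit n r := Sum.inr (Sum.inr (Sum.inl (i, k)))

abbrev corrBit (n : ℕ) (k : Fin r) : WorkBit n r := Sum.inr (Sum.inr (Sum.inr (Sum.inl k)))

abbrev outBit (n r : ℕ) : WorkBit n r := Sum.inr (Sum.inr (Sum.inr (Sum.inr ())))

/-- The qubits of a register. -/
def regEmb (r : ℕ) (i : Fin (n + 1)) : Fin r ↪ Qubit n r :=
  ⟨reg i, fun k k' h => by simpa using h⟩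

/-- The qubits of a link and a register. -/
def pairEmb (r : ℕ) (i : Fin n) (j : Fin (n + 1)) : Fin r ⊕ Fin r ↪ Qubit n r :=
  ⟨Sum.elim (link i) (reg j), by
    rintro (k | k) (k' | k') h <;> simp_all⟩

lemma regEmb_apply (i : Fin (n + 1)) (k : Fin r) : regEmb r i k = reg i k := rfl

lemma pairEmb_inl (i : Fin n) (j : Fin (n + 1)) (k : Fin r) :
    pairEmb r i j (Sum.inl k) = link i k := rfl

lemma pairEmb_inr (i : Fin n) (j : Fin (n + 1)) (k : Fin r) :
    pairEmb r i j (Sum.inr k) = reg j k := rfl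

lemma extend_regEmb_link (i : Fin (n + 1)) (w : Fin r → ZMod 2) (z : Qubit n r → ZMod 2)
    (y : Fin n × Fin r) : Function.extend (regEmb r i) w z (Sum.inr y) = z (Sum.inr y) :=
  Function.extend_apply' _ _ _ (by simp [regEmb_apply])

lemma extend_regEmb_of_ne {i j : Fin (n + 1)} (h : i ≠ j) (w : Fin r → ZMod 2)
    (z : Qubit n r → ZMod 2) (k : Fin r) :
    Function.extend (regEmb r i) w z (reg j k) = z (reg j k) :=
  Function.extend_apply' _ _ _ (by simp [regEmb_apply, h])

lemma extend_pairEmb_link_self (i : Fin n) (j : Fin (n + 1)) (w : Fin r ⊕ Fin r → ZMod 2)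
    (z : Qubit n r → ZMod 2) (k : Fin r) :
    Function.extend (pairEmb r i j) w z (link i k) = w (Sum.inl k) :=
  (pairEmb r i j).injective.extend_apply w z (Sum.inl k)

lemma extend_pairEmb_reg_self (i : Fin n) (j : Fin (n + 1)) (w : Fin r ⊕ Fin r → ZMod 2)
    (z : Qubit n r → ZMod 2) (k : Fin r) :
    Function.extend (pairEmb r i j) w z (reg j k) = w (Sum.inr k) :=
  (pairEmb r i j).injective.extend_apply w z (Sum.inr k)

lemma extend_pairEmb_link_of_ne {i i' : Fin n} (h : i ≠ i') (j : Fin (n + 1))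
    (w : Fin r ⊕ Fin r → ZMod 2) (z : Qubit n r → ZMod 2) (k : Fin r) :
    Function.extend (pairEmb r i j) w z (link i' k) = z (link i' k) :=
  Function.extend_apply' _ _ _ (by simp [pairEmb_inl, pairEmb_inr, h])

lemma extend_pairEmb_reg_of_ne (i : Fin n) {j j' : Fin (n + 1)} (h : j ≠ j')
    (w : Fin r ⊕ Fin r → ZMod 2) (z : Qubit n r → ZMod 2) (k : Fin r) :
    Function.extend (pairEmb r i j) w z (reg j' k) = z (reg j' k) :=
  Function.extend_apply' _ _ _ (by simp [pairEmb_inl, pairEmb_inr, h])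

/-- The map that adds the second half of the coordinates to the first half. -/
def cnotPerm (r : ℕ) : Equiv.Perm (Fin r ⊕ Fin r → ZMod 2) :=
  Function.Involutive.toPerm
    (fun v => Sum.elim (fun k => v (Sum.inl k) + v (Sum.inr k)) fun k => v (Sum.inr k)) (by
      intro v
      funext y
      rcases y with k | k
      · simp [add_assoc, CharTwo.add_self_eq_zero]
      · rfl)

lemma cnotPerm_inl (v : Fin r ⊕ Fin r → ZMod 2) (k : Fin r) :
    cnotPerm r v (Sum.inl k) = v (Sum.inl k) + v (Sum.inr k) := rfl

lemma cnotPerm_inr (v : Fin r ⊕ Fin r → ZMod 2) (k : Fin r) :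
    cnotPerm r v (Sum.inr k) = v (Sum.inr k) := rfl

lemma prod_ite_zero {ι : Type*} [Fintype ι] (P : ι → Prop) [DecidablePred P]
    [Decidable (∀ i, P i)] (f : ι → ℂ) :
    ∏ i, (if P i then f i else 0) = if ∀ i, P i then ∏ i, f i else 0 := by
  rw [Fintype.prod_ite_zero]
  congr

lemma sign_sum {ι : Type*} (s : Finset ι) (f : ι → ZMod 2) :
    sign (∑ i ∈ s, f i) = ∏ i ∈ s, sign (f i) := by
  classical
  induction s using Finset.induction_on with
  | empty => simp
  | insert i s hi ih => rw [Finset.sum_insert hi, Finset.prod_insert hi, AddChar.map_add_eq_mul, ih]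

/-- Successive differences determine a sequence up to its first term, by partial sums. -/
lemma forall_add_eq_succ_iff (m : Fin n → ZMod 2) (a : Fin (n + 1) → ZMod 2) :
    (∀ i : Fin n, m i + a i.castSucc = a i.succ) ↔
      ∀ i : Fin n, a i.succ = a 0 + ∑ j : {j : Fin n // j ≤ i}, m j := by
  -- The strict inequality gives `s 0 = 0`, while `s i.succ` still includes the term `m i`.
  let s : Fin (n + 1) → ZMod 2 := fun i => ∑ j : Fin n, if j.castSucc < i then m j else 0
  have hs0 : s 0 = 0 := by simp [s]
  have hsucc : ∀ i : Fin n, s i.succ = m i + s i.castSucc := by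
    intro i
    have : ∀ j : Fin n, (if j.castSucc < i.succ then m j else 0) =
        (if j = i then m j else 0) + if j.castSucc < i.castSucc then m j else 0 := by
      intro j
      rcases lt_trichotomy j i with h | rfl | h
      · have h1 : j.castSucc < i.succ := by rw [Fin.lt_def] at *; simp; omega
        simp [h1, h, h.ne]
      · simp
      · have h1 : ¬ j.castSucc < i.succ := by rw [Fin.lt_def] at *; simp; omega
        simp [h1, h.ne', h.le]
    simp only [s, this, Finset.sum_add_distrib]
    simp
  have hsum : ∀ i : Fin n, ∑ j : {j : Fin n // j ≤ i}, m j = s i.succ := by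
    intro i
    rw [← Finset.sum_subtype (Finset.univ.filter (· ≤ i)) (by simp) m, Finset.sum_filter]
    refine Finset.sum_congr rfl fun j _ => if_congr ?_ rfl rfl
    rw [Fin.lt_def, Fin.le_def]
    simp
  simp only [hsum]
  constructor
  · intro h
    have : ∀ i, a i = a 0 + s i := by
      intro i
      induction i using Fin.induction with
      | zero => simp [hs0]
      | succ i ih => rw [← h, ih, hsucc]; ring
    exact fun i => this _
  · intro h
    have : ∀ i, a i = a 0 + s i := by
      intro i
      cases i using Fin.cases with
      | zero => simp [hs0]
      | succ i => exact h i
    intro i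
    rw [this i.castSucc, h, hsucc]
    ring

variable (n) in
/-- Preparation of register `0`. -/
noncomputable def prepareSource (U : Matrix.unitaryGroup (Fin r → ZMod 2) ℂ) :
    List (Op n (Fintype.card (Qubit n r)) (Fintype.card (WorkBit n r))) :=
  layer fun _ : Unit => gateOp (regEmb r 0) (Empty.elim : Empty → Fin n ⊕ WorkBit n r) fun _ => U

variable (n) in
/-- Preparation of the pairs formed by link `i` and register `i + 1`. -/
noncomputable def preparePairs (T : Matrix.unitaryGroup (Fin r ⊕ Fin r → ZMod 2) ℂ) :
    List (Op n (Fintype.card (Qubit n r)) (Fintype.card (WorkBit n r))) :=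
  layer fun i : Fin n =>
    gateOp (pairEmb r i i.succ) (Empty.elim : Empty → Fin n ⊕ WorkBit n r) fun _ => T

variable (n r) in
/-- Register `i` is added to link `i`. -/
noncomputable def connect : List (Op n (Fintype.card (Qubit n r)) (Fintype.card (WorkBit n r))) :=
  layer fun i : Fin n =>
    gateOp (pairEmb r i i.castSucc) (Empty.elim : Empty → Fin n ⊕ WorkBit n r)
      fun _ => permUnitary (cnotPerm r)

variable (n r) in
/-- Measurement of the links. -/
noncomputable def measureLinks :
    List (Op n (Fintype.card (Qubit n r)) (Fintype.card (WorkBit n r))) :=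
  layer fun y : Fin n × Fin r => measureOp n (link y.1 y.2) (linkBit y.1 y.2)

variable (n r) in
/-- The shift of register `i + 1` against register `0`. -/
noncomputable def queryShifts :
    List (Op n (Fintype.card (Qubit n r)) (Fintype.card (WorkBit n r))) :=
  layer fun y : Fin n × Fin r => queryOp (Qubit n r)
    (fun j : {j : Fin n // j ≤ y.1} => Sum.inr (linkBit j.1 y.2)) (shiftBit y.1 y.2)

/-- The phase of the string `w` shifted by the bits `y (some k)`, if the bit `y none` is set. -/
noncomputable def phase (φ : (Fin r → ZMod 2) → ℂ) (y : Option (Fin r) → ZMod 2)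
    (w : Fin r → ZMod 2) : ℂ :=
  if y none = 0 then 1 else φ (w + y ∘ some)

lemma phase_mul_star {φ : (Fin r → ZMod 2) → ℂ} (hφ : ∀ w, φ w * star (φ w) = 1)
    (y : Option (Fin r) → ZMod 2) (w : Fin r → ZMod 2) : phase φ y w * star (phase φ y w) = 1 := by
  rw [phase]
  split_ifs
  · simp
  · exact hφ _

/-- The control bits of the phase gate on register `i + 1`. -/
def phaseControl (i : Fin n) : Option (Fin r) → Fin n ⊕ WorkBit n r :=
  fun y => y.elim (Sum.inl i) fun k => Sum.inr (shiftBit i k)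

variable (n) in
/-- Phases on the registers `1, …, n`, followed by Hadamard transforms. -/
noncomputable def applyPhases (H : Matrix.unitaryGroup (Fin r → ZMod 2) ℂ)
    (φ : (Fin r → ZMod 2) → ℂ) (hφ : ∀ w, φ w * star (φ w) = 1) :
    List (Op n (Fintype.card (Qubit n r)) (Fintype.card (WorkBit n r))) :=
  layer fun i : Fin n => gateOp (regEmb r i.succ) (phaseControl i)
    fun y => H * diagUnitary (phase φ y) (phase_mul_star hφ y)

variable (n r) in
/-- Measurement of the registers `1, …, n`. -/
noncomputable def measureRegs :
    List (Op n (Fintype.card (Qubit n r)) (Fintype.card (WorkBit n r))) :=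
  layer fun y : Fin n × Fin r => measureOp n (reg y.1.succ y.2) (regBit y.1 y.2)

variable (n r) in
/-- The parities of the outcomes for the registers. -/
noncomputable def queryCorrection :
    List (Op n (Fintype.card (Qubit n r)) (Fintype.card (WorkBit n r))) :=
  layer fun k : Fin r => queryOp (Qubit n r)
    (fun i : Fin n => Sum.inr (regBit i k)) (corrBit n k)

lemma sign_mul_star (b : ZMod 2) : sign b * star (sign b) = 1 := by
  rw [star_sign, sign_mul_self]

variable (n) in
/-- The correction of register `0`, followed by a change of basis. -/
noncomputable def decode (W : Matrix.unitaryGroup (Fin r → ZMod 2) ℂ) :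
    List (Op n (Fintype.card (Qubit n r)) (Fintype.card (WorkBit n r))) :=
  layer fun _ : Unit => gateOp (regEmb r 0) (fun k : Fin r => Sum.inr (corrBit n k))
    fun y => W * diagUnitary (fun w => sign (y ⬝ᵥ w)) fun _ => sign_mul_star _

variable (n) in
/-- Measurement of the output. -/
noncomputable def measureOut (k₀ : Fin r) :
    List (Op n (Fintype.card (Qubit n r)) (Fintype.card (WorkBit n r))) :=
  layer fun _ : Unit => measureOp n (reg 0 k₀) (outBit n r)

/-! ### The state after each layer -/

variable {g : BoolFamily} {x : Fin n → ZMod 2}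

/-- The branch is in the state `F a`, up to a scalar, on input `x`. -/
def InState (x : Fin n → ZMod 2)
    (F : (Fin n ⊕ WorkBit n r → ZMod 2) → (Qubit n r → ZMod 2) → ℂ) :
    BPred n (Qubit n r) (WorkBit n r) :=
  fun a ψ => (∀ i, a (Sum.inl i) = x i) ∧ ∃ C : ℂ, ∀ z, ψ z = C * F a z

lemma triple_prepareSource {U : Matrix.unitaryGroup (Fin r → ZMod 2) ℂ}
    {α : (Fin r → ZMod 2) → ℂ}
    (hU : ∀ w, (U : Matrix (Fin r → ZMod 2) (Fin r → ZMod 2) ℂ) w 0 = α w) :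
    Triple g (InState x fun _ z => if z = 0 then 1 else 0) (prepareSource n U)
      (InState x fun _ z =>
        if ∀ i k, z (link i k) = 0 ∧ z (reg i.succ k) = 0 then α (z ∘ regEmb r 0) else 0) := by
  refine Triple.gateLayer (fun _ _ _ _ _ => rfl) ?_
  rintro a ψ ⟨hx, C, hψ⟩
  refine ⟨fun z => C * if ∀ i k, z (link i k) = 0 ∧ z (reg i.succ k) = 0 then 1 else 0,
    fun _ _ v => if v = 0 then 1 else 0, fun z => ?_, fun _ w z => ?_, fun _ _ _ _ => rfl,
    hx, C, fun z => ?_⟩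
  · rw [hψ, Finset.univ_unique, Finset.prod_singleton, mul_assoc, ite_zero_mul_ite_zero, mul_one]
    congr 1
    refine if_congr ⟨?_, ?_⟩ rfl rfl
    · rintro rfl
      exact ⟨fun _ _ => ⟨rfl, rfl⟩, rfl⟩
    · rintro ⟨h, h0⟩
      funext y
      rcases y with ⟨i, k⟩ | ⟨i, k⟩
      · cases i using Fin.cases with
        | zero => exact congrFun h0 k
        | succ i => exact (h i k).2
      · exact (h i k).1
  · simp only [extend_regEmb_link, extend_regEmb_of_ne (Fin.succ_ne_zero _).symm]
  · simp [hU]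

lemma triple_preparePairs {T : Matrix.unitaryGroup (Fin r ⊕ Fin r → ZMod 2) ℂ} {c : ℂ}
    (α : (Fin r → ZMod 2) → ℂ)
    (hT : ∀ w, (T : Matrix (Fin r ⊕ Fin r → ZMod 2) (Fin r ⊕ Fin r → ZMod 2) ℂ) w 0 =
      c * if ∀ k, w (Sum.inl k) = w (Sum.inr k) then 1 else 0) :
    Triple g
      (InState x fun _ z =>
        if ∀ i k, z (link i k) = 0 ∧ z (reg i.succ k) = 0 then α (z ∘ regEmb r 0) else 0)
      (preparePairs n T)
      (InState x fun _ z =>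
        if ∀ i k, z (link i k) = z (reg i.succ k) then α (z ∘ regEmb r 0) else 0) := by
  refine Triple.gateLayer ?_ ?_
  · rintro i j (k | k) (k' | k') h <;>
      simp only [pairEmb_inl, pairEmb_inr, Sum.inl.injEq, Sum.inr.injEq, Prod.mk.injEq,
        Fin.succ_inj, reduceCtorEq] at h <;> exact h.1
  rintro a ψ ⟨hx, C, hψ⟩
  refine ⟨fun z => C * α (z ∘ regEmb r 0), fun _ _ v => if v = 0 then 1 else 0, fun z => ?_,
    fun i w z => ?_, fun _ _ _ _ => rfl, hx, C * c ^ n, fun z => ?_⟩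
  · rw [hψ, prod_ite_zero, Finset.prod_const_one, mul_ite, mul_ite, mul_one, mul_zero, mul_zero]
    refine if_congr (forall_congr' fun i => ?_) rfl rfl
    simp only [funext_iff, Sum.forall, Function.comp_apply, pairEmb_inl, pairEmb_inr,
      Pi.zero_apply, forall_and]
  · have h0 : Function.extend (pairEmb r i i.succ) w z ∘ regEmb r 0 = z ∘ regEmb r 0 :=
      funext fun k => extend_pairEmb_reg_of_ne i (Fin.succ_ne_zero _) w z k
    simp only [h0]
  · simp only [mul_ite, mul_one, mul_zero, Finset.sum_ite_eq', Finset.mem_univ, if_true, hT]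
    rw [prod_ite_zero, Finset.prod_const, Finset.card_univ, Fintype.card_fin, mul_ite,
      mul_zero]
    refine if_congr Iff.rfl ?_ rfl
    ring

/-- Link `i` is entangled with register `i + 1` but gate `i` joins it to register `i`, so the state
does not factor over the gates and `Triple.gateLayer` does not fit. The gates are followed one at a
time; they change links only. -/
lemma triple_connect (α : (Fin r → ZMod 2) → ℂ) :
    Triple g
      (InState x fun _ z =>
        if ∀ i k, z (link i k) = z (reg i.succ k) then α (z ∘ regEmb r 0) else 0)
      (connect n r)
      (InState x fun _ z =>
        if ∀ i k, z (link i k) + z (reg i.castSucc k) = z (reg i.succ k)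
        then α (z ∘ regEmb r 0) else 0) := by
  have key := Triple.of_layer (g := g) (op := fun i : Fin n =>
    gateOp (pairEmb r i i.castSucc) (Empty.elim : Empty → Fin n ⊕ WorkBit n r)
      fun _ => permUnitary (cnotPerm r))
    (fun s : Finset (Fin n) => InState x fun _ z =>
        if ∀ i k, z (link i k) + (if i ∈ s then z (reg i.castSucc k) else 0) = z (reg i.succ k)
        then α (z ∘ regEmb r 0) else 0) (by
      intro s i hi
      refine Triple.gate ?_
      rintro a ψ ⟨hx, C, hψ⟩
      refine ⟨hx, C, fun z => ?_⟩
      refine (sum_permUnitary_mul _ _ fun w =>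
        ψ (Function.extend (pairEmb r i i.castSucc) w z)).trans ?_
      rw [hψ]
      set z' := Function.extend (pairEmb r i i.castSucc)
        (cnotPerm r (z ∘ pairEmb r i i.castSucc)) z with hz'
      have hreg : ∀ j k, z' (reg j k) = z (reg j k) := by
        intro j k
        by_cases hj : i.castSucc = j
        · subst hj
          rw [hz', extend_pairEmb_reg_self, cnotPerm_inr]
          rfl
        · rw [hz', extend_pairEmb_reg_of_ne i hj]
      have hlink : ∀ j k, z' (link j k) =
          z (link j k) + if j = i then z (reg i.castSucc k) else 0 := by
        intro j k
        by_cases hj : i = j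
        · subst hj
          rw [hz', extend_pairEmb_link_self, cnotPerm_inl, if_pos rfl]
          rfl
        · rw [hz', extend_pairEmb_link_of_ne hj, if_neg (Ne.symm hj), add_zero]
      have h0 : z' ∘ regEmb r 0 = z ∘ regEmb r 0 := funext fun k => hreg 0 k
      simp only [h0]
      congr 1
      refine if_congr (forall₂_congr fun j k => ?_) rfl rfl
      rw [hlink, hreg, hreg]
      by_cases hj : j = i
      · subst hj
        simp [hi]
      · simp [hj])
  simpa [connect] using key

lemma triple_measureLinks (α : (Fin r → ZMod 2) → ℂ) :
    Triple g
      (InState x fun _ z =>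
        if ∀ i k, z (link i k) + z (reg i.castSucc k) = z (reg i.succ k)
        then α (z ∘ regEmb r 0) else 0)
      (measureLinks n r)
      (InState x fun a z =>
        if ∀ i k, z (link i k) = a (Sum.inr (linkBit i k)) then
          if ∀ i k, z (link i k) + z (reg i.castSucc k) = z (reg i.succ k)
          then α (z ∘ regEmb r 0) else 0
        else 0) := by
  refine Triple.measureLayer (fun y y' h => by simpa [Prod.ext_iff] using h) ?_
  rintro a₀ ψ a ⟨hx, C, hψ⟩ ha
  refine ⟨fun i => by rw [ha _ (by simp), hx], C, fun z => ?_⟩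
  simp only [Prod.forall, hψ, mul_ite, mul_zero]

/-- Once the links equal their outcomes, the condition on the support prescribes successive
differences of registers, and the queried prefix sums solve it. -/
lemma triple_queryShifts (α : (Fin r → ZMod 2) → ℂ) :
    Triple (modFn 2 0)
      (InState x fun a z =>
        if ∀ i k, z (link i k) = a (Sum.inr (linkBit i k)) then
          if ∀ i k, z (link i k) + z (reg i.castSucc k) = z (reg i.succ k)
          then α (z ∘ regEmb r 0) else 0
        else 0)
      (queryShifts n r)
      (InState x fun a z =>
        if ∀ i k, z (link i k) = a (Sum.inr (linkBit i k)) then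
          if ∀ i k, z (reg i.succ k) = z (reg 0 k) + a (Sum.inr (shiftBit i k))
          then α (z ∘ regEmb r 0) else 0
        else 0) := by
  refine Triple.queryLayer (fun y y' h => by simpa [Prod.ext_iff] using h) (by simp) ?_
  rintro a₀ ψ a ⟨hx, C, hψ⟩ ha hs
  refine ⟨fun i => by rw [ha _ (by simp), hx], C, fun z => ?_⟩
  have hlink : ∀ i k, a₀ (Sum.inr (linkBit i k)) = a (Sum.inr (linkBit i k)) :=
    fun i k => (ha _ (by simp)).symm
  simp only [hψ, hlink]
  congr 1
  split_ifs with h1 h2 h3 h3 <;> try rfl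
  all_goals
    exfalso
    have e : (∀ i k, z (link i k) + z (reg i.castSucc k) = z (reg i.succ k)) ↔
        ∀ i k, z (reg i.succ k) = z (reg 0 k) + a (Sum.inr (shiftBit i k)) := by
      have hk := fun k => forall_add_eq_succ_iff (fun i => z (link i k)) fun i => z (reg i k)
      rw [forall_comm, forall_congr' hk, forall_comm]
      refine forall₂_congr fun i k => ?_
      rw [hs (i, k)]
      simp only [h1]
    tauto

lemma add_add_cancel_right_pi (v w : Fin r → ZMod 2) : v + w + w = v := by
  funext k
  simp [add_assoc, CharTwo.add_self_eq_zero]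

/-- Given register 0, each copy is a basis state, so the state factors over the copies. The gate
adds the shift a second time, which cancels it in characteristic two, and each set input bit
contributes `φ` at register 0. The Hadamard transform turns the basis state into a sign. -/
lemma triple_applyPhases {H : Matrix.unitaryGroup (Fin r → ZMod 2) ℂ} {h : ℂ}
    (hH : ∀ v w, (H : Matrix (Fin r → ZMod 2) (Fin r → ZMod 2) ℂ) v w = h * sign (v ⬝ᵥ w))
    (φ α : (Fin r → ZMod 2) → ℂ) (hφ : ∀ w, φ w * star (φ w) = 1) :
    Triple g
      (InState x fun a z =>
        if ∀ i k, z (link i k) = a (Sum.inr (linkBit i k)) then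
          if ∀ i k, z (reg i.succ k) = z (reg 0 k) + a (Sum.inr (shiftBit i k))
          then α (z ∘ regEmb r 0) else 0
        else 0)
      (applyPhases n H φ hφ)
      (InState x fun a z =>
        if ∀ i k, z (link i k) = a (Sum.inr (linkBit i k)) then
          α (z ∘ regEmb r 0) * φ (z ∘ regEmb r 0) ^ hammingNorm x *
            ∏ i : Fin n, sign ((z ∘ regEmb r i.succ) ⬝ᵥ
              (z ∘ regEmb r 0 + fun k => a (Sum.inr (shiftBit i k))))
        else 0) := by
  refine Triple.gateLayer ?_ ?_
  · intro i j k k' h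
    simp only [regEmb_apply, Sum.inl.injEq, Prod.mk.injEq, Fin.succ_inj] at h
    exact h.1
  rintro a ψ ⟨hx, C, hψ⟩
  have h0 : ∀ (i : Fin n) (w : Fin r → ZMod 2) z, Function.extend (regEmb r i.succ) w z ∘ regEmb r 0 =
      z ∘ regEmb r 0 := by
    intro i w z
    funext k
    exact extend_regEmb_of_ne (Fin.succ_ne_zero i) w z k
  let v : Fin n → Fin r → ZMod 2 := fun i k => a (Sum.inr (shiftBit i k))
  refine ⟨fun z => C * if ∀ i k, z (link i k) = a (Sum.inr (linkBit i k)) then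
      α (z ∘ regEmb r 0) else 0,
    fun i z w => if w = z ∘ regEmb r 0 + v i then 1 else 0, fun z => ?_, fun i w z => ?_,
    fun j i w z => ?_, hx, C * h ^ n, fun z => ?_⟩
  · rw [hψ, prod_ite_zero, Finset.prod_const_one]
    simp only [funext_iff, Function.comp_apply, regEmb_apply, Pi.add_apply, v]
    split_ifs <;> simp
  · simp only [h0, extend_regEmb_link]
  · simp only [h0]
  · simp only [mul_ite, mul_one, mul_zero, Finset.sum_ite_eq', Finset.mem_univ, if_true,
      mul_diagUnitary_apply, hH]
    have hphase : ∀ i, phase φ (a ∘ phaseControl i) (z ∘ regEmb r 0 + v i) =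
        if x i = 0 then 1 else φ (z ∘ regEmb r 0) := by
      intro i
      have h1 : (a ∘ phaseControl i) ∘ some = v i := rfl
      have h2 : (a ∘ phaseControl (r := r) i) none = x i := hx i
      rw [phase, h1, h2, add_add_cancel_right_pi]
    have hprod : ∏ i, (if x i = 0 then 1 else φ (z ∘ regEmb r 0)) =
        φ (z ∘ regEmb r 0) ^ hammingNorm x := by
      rw [Finset.prod_ite, Finset.prod_const_one, one_mul, Finset.prod_const]
      rfl
    simp only [hphase, Finset.prod_mul_distrib, hprod, Finset.prod_const, Finset.card_univ,
      Fintype.card_fin]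
    split_ifs
    · ring
    · simp

/-- For fixed outcomes the signs split into a part involving register 0 only through the sum of the
outcomes, and a part fixed by classical bits, which is absorbed into the scalar. -/
lemma triple_measureRegs (φ α : (Fin r → ZMod 2) → ℂ) :
    Triple g
      (InState x fun a z =>
        if ∀ i k, z (link i k) = a (Sum.inr (linkBit i k)) then
          α (z ∘ regEmb r 0) * φ (z ∘ regEmb r 0) ^ hammingNorm x *
            ∏ i : Fin n, sign ((z ∘ regEmb r i.succ) ⬝ᵥ
              (z ∘ regEmb r 0 + fun k => a (Sum.inr (shiftBit i k))))
        else 0)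
      (measureRegs n r)
      (InState x fun a z =>
        (if ∀ i k, z (link i k) = a (Sum.inr (linkBit i k)) ∧
            z (reg i.succ k) = a (Sum.inr (regBit i k)) then 1 else 0) *
          (α (z ∘ regEmb r 0) * φ (z ∘ regEmb r 0) ^ hammingNorm x *
            sign ((fun k => ∑ i : Fin n, a (Sum.inr (regBit i k))) ⬝ᵥ (z ∘ regEmb r 0)))) := by
  refine Triple.measureLayer (fun y y' h => by simpa [Prod.ext_iff] using h) ?_
  rintro a₀ ψ a ⟨hx, C, hψ⟩ ha
  let v : Fin n → Fin r → ZMod 2 := fun i k => a (Sum.inr (shiftBit i k))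
  let y : Fin n → Fin r → ZMod 2 := fun i k => a (Sum.inr (regBit i k))
  refine ⟨fun i => by rw [ha _ (by simp), hx], C * ∏ i, sign (y i ⬝ᵥ v i), fun z => ?_⟩
  have hlink : ∀ i k, a₀ (Sum.inr (linkBit i k)) = a (Sum.inr (linkBit i k)) :=
    fun i k => (ha _ (by simp)).symm
  have hshift : ∀ i k, a₀ (Sum.inr (shiftBit i k)) = a (Sum.inr (shiftBit i k)) :=
    fun i k => (ha _ (by simp)).symm
  simp only [Prod.forall, hψ, hlink, hshift]
  by_cases h1 : ∀ i k, z (reg i.succ k) = a (Sum.inr (regBit i k))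
  · by_cases h2 : ∀ i k, z (link i k) = a (Sum.inr (linkBit i k))
    · rw [if_pos h1, if_pos h2, if_pos fun i k => ⟨h2 i k, h1 i k⟩]
      have hreg : ∀ i : Fin n, z ∘ regEmb r i.succ = y i := fun i => funext fun k => h1 i k
      have hsum : (fun k => ∑ i : Fin n, a (Sum.inr (regBit i k))) = ∑ i, y i := by
        funext k
        simp [y]
      have hsplit : ∏ i, sign (y i ⬝ᵥ (z ∘ regEmb r 0 + v i)) =
          sign ((∑ i, y i) ⬝ᵥ (z ∘ regEmb r 0)) * ∏ i, sign (y i ⬝ᵥ v i) := by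
        simp only [dotProduct_add, AddChar.map_add_eq_mul, Finset.prod_mul_distrib]
        rw [sum_dotProduct, sign_sum]
      simp only [hreg, hsum]
      rw [hsplit]
      ring
    · have h3 : ¬ ∀ i k, z (link i k) = a (Sum.inr (linkBit i k)) ∧
          z (reg i.succ k) = a (Sum.inr (regBit i k)) := fun h => h2 fun i k => (h i k).1
      rw [if_neg h2, if_neg h3]
      simp
  · have h3 : ¬ ∀ i k, z (link i k) = a (Sum.inr (linkBit i k)) ∧
        z (reg i.succ k) = a (Sum.inr (regBit i k)) := fun h => h1 fun i k => (h i k).2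
    rw [if_neg h1, if_neg h3]
    simp

lemma triple_queryCorrection (φ α : (Fin r → ZMod 2) → ℂ) :
    Triple (modFn 2 0)
      (InState x fun a z =>
        (if ∀ i k, z (link i k) = a (Sum.inr (linkBit i k)) ∧
            z (reg i.succ k) = a (Sum.inr (regBit i k)) then 1 else 0) *
          (α (z ∘ regEmb r 0) * φ (z ∘ regEmb r 0) ^ hammingNorm x *
            sign ((fun k => ∑ i : Fin n, a (Sum.inr (regBit i k))) ⬝ᵥ (z ∘ regEmb r 0))))
      (queryCorrection n r)
      (InState x fun a z =>
        (if ∀ i k, z (link i k) = a (Sum.inr (linkBit i k)) ∧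
            z (reg i.succ k) = a (Sum.inr (regBit i k)) then 1 else 0) *
          (α (z ∘ regEmb r 0) * φ (z ∘ regEmb r 0) ^ hammingNorm x *
            sign ((fun k => a (Sum.inr (corrBit n k))) ⬝ᵥ (z ∘ regEmb r 0)))) := by
  refine Triple.queryLayer (fun y y' h => by simpa using h) (by simp) ?_
  rintro a₀ ψ a ⟨hx, C, hψ⟩ ha hs
  refine ⟨fun i => by rw [ha _ (by simp), hx], C, fun z => ?_⟩
  have hlink : ∀ i k, a₀ (Sum.inr (linkBit i k)) = a (Sum.inr (linkBit i k)) :=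
    fun i k => (ha _ (by simp)).symm
  have hreg : ∀ i k, a₀ (Sum.inr (regBit i k)) = a (Sum.inr (regBit i k)) :=
    fun i k => (ha _ (by simp)).symm
  simp only [hψ, hlink, hreg, hs]

lemma triple_decode (W : Matrix.unitaryGroup (Fin r → ZMod 2) ℂ) (φ α : (Fin r → ZMod 2) → ℂ) :
    Triple g
      (InState x fun a z =>
        (if ∀ i k, z (link i k) = a (Sum.inr (linkBit i k)) ∧
            z (reg i.succ k) = a (Sum.inr (regBit i k)) then 1 else 0) *
          (α (z ∘ regEmb r 0) * φ (z ∘ regEmb r 0) ^ hammingNorm x *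
            sign ((fun k => a (Sum.inr (corrBit n k))) ⬝ᵥ (z ∘ regEmb r 0))))
      (decode n W)
      (InState x fun a z =>
        (if ∀ i k, z (link i k) = a (Sum.inr (linkBit i k)) ∧
            z (reg i.succ k) = a (Sum.inr (regBit i k)) then 1 else 0) *
          ∑ w, (W : Matrix (Fin r → ZMod 2) (Fin r → ZMod 2) ℂ) (z ∘ regEmb r 0) w *
            (α w * φ w ^ hammingNorm x)) := by
  refine Triple.gateLayer (fun _ _ _ _ _ => rfl) ?_
  rintro a ψ ⟨hx, C, hψ⟩
  refine ⟨fun z => C * if ∀ i k, z (link i k) = a (Sum.inr (linkBit i k)) ∧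
      z (reg i.succ k) = a (Sum.inr (regBit i k)) then 1 else 0,
    fun _ _ w => α w * φ w ^ hammingNorm x * sign ((fun k => a (Sum.inr (corrBit n k))) ⬝ᵥ w),
    fun z => ?_, fun _ w z => ?_, fun _ _ _ _ => rfl, hx, C, fun z => ?_⟩
  · rw [hψ, Finset.univ_unique, Finset.prod_singleton, mul_assoc]
  · simp only [extend_regEmb_link, extend_regEmb_of_ne (Fin.succ_ne_zero _).symm]
  · simp only [Finset.univ_unique, Finset.prod_const, Finset.card_singleton, pow_one]
    rw [mul_assoc]
    congr 2
    refine Finset.sum_congr rfl fun w _ => ?_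
    rw [mul_diagUnitary_apply]
    have h1 := sign_mul_self ((fun k => a (Sum.inr (corrBit n k))) ⬝ᵥ w)
    change _ * sign ((fun k => a (Sum.inr (corrBit n k))) ⬝ᵥ w) * _ = _
    linear_combination (W : Matrix (Fin r → ZMod 2) (Fin r → ZMod 2) ℂ) (z ∘ regEmb r 0) w *
      (α w * φ w ^ hammingNorm x) * h1

/-- After the last projection only amplitudes of register 0 whose bit `k₀` equals the output remain;
by `hW` they vanish for a wrong output. -/
lemma triple_measureOut (W : Matrix.unitaryGroup (Fin r → ZMod 2) ℂ)
    (φ α : (Fin r → ZMod 2) → ℂ) (k₀ : Fin r) (f : ZMod 2)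
    (hW : ∀ v : Fin r → ZMod 2, v k₀ ≠ f →
      ∑ w, (W : Matrix (Fin r → ZMod 2) (Fin r → ZMod 2) ℂ) v w *
        (α w * φ w ^ hammingNorm x) = 0) :
    Triple g
      (InState x fun a z =>
        (if ∀ i k, z (link i k) = a (Sum.inr (linkBit i k)) ∧
            z (reg i.succ k) = a (Sum.inr (regBit i k)) then 1 else 0) *
          ∑ w, (W : Matrix (Fin r → ZMod 2) (Fin r → ZMod 2) ℂ) (z ∘ regEmb r 0) w *
            (α w * φ w ^ hammingNorm x))
      (measureOut n k₀)
      (fun a ψ => a (Sum.inr (outBit n r)) ≠ f → ψ = 0) := by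
  refine Triple.measureLayer (fun _ _ _ => rfl) ?_
  rintro a₀ ψ a ⟨hx, C, hψ⟩ ha hne
  funext z
  simp only [forall_const, hψ]
  split_ifs with h1 h2
  · rw [hW (z ∘ regEmb r 0) (by rw [Function.comp_apply, regEmb_apply, h1]; exact hne)]
    simp
  · simp
  · rfl

end ModCircuit

end QCircuit

namespace QCircuit

/-! ### Assembly, resource bounds and correctness -/

section ModCircuit

variable {n r : ℕ}

/-- The circuit that computes the Hamming weight of the input in the phases of register `0` and
then measures one qubit of this register. -/
noncomputable def modCircuit (n : ℕ) {r : ℕ} (k₀ : Fin r)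
    (U W H : Matrix.unitaryGroup (Fin r → ZMod 2) ℂ)
    (T : Matrix.unitaryGroup (Fin r ⊕ Fin r → ZMod 2) ℂ)
    (φ : (Fin r → ZMod 2) → ℂ) (hφ : ∀ w, φ w * star (φ w) = 1) : QCircuit n where
  qubits := Fintype.card (Qubit n r)
  bits := Fintype.card (WorkBit n r)
  layers := [prepareSource n U, preparePairs n T, connect n r, measureLinks n r, queryShifts n r,
    applyPhases n H φ hφ, measureRegs n r, queryCorrection n r, decode n W, measureOut n k₀]
  out := cbit n (WorkBit n r) (Sum.inr (outBit n r))
  parallel := by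
    simp only [List.forall_mem_cons, List.not_mem_nil, false_implies, implies_true, and_true]
    refine ⟨?_, ?_, ?_, ?_, ?_, ?_, ?_, ?_, ?_, ?_⟩
    · exact pairwise_layer fun i j h => absurd rfl h
    · refine pairwise_layer fun i j h => parallel_gate ?_ fun i => i.elim
      rintro (k | k) (k' | k') <;> simp [pairEmb_inl, pairEmb_inr, h]
    · refine pairwise_layer fun i j h => parallel_gate ?_ fun i => i.elim
      rintro (k | k) (k' | k') <;> simp [pairEmb_inl, pairEmb_inr, h]
    · refine pairwise_layer fun i j h => parallel_measure ?_ ?_ <;> simpa using h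
    · refine pairwise_layer fun i j h => parallel_query ?_ ?_ ?_
      · simpa using h
      · simp
      · simp
    · refine pairwise_layer fun i j h => parallel_gate ?_ ?_
      · simp [regEmb_apply, h]
      · rintro (_ | k) (_ | k') <;> simp [phaseControl, h]
    · refine pairwise_layer fun i j h => parallel_measure ?_ ?_
      · simpa [Prod.ext_iff] using h
      · simpa using h
    · refine pairwise_layer fun i j h => parallel_query ?_ ?_ ?_
      · simpa using h
      · simp
      · simp
    · exact pairwise_layer fun i j h => absurd rfl h
    · exact pairwise_layer fun i j h => absurd rfl h

variable {k₀ : Fin r} {U W H : Matrix.unitaryGroup (Fin r → ZMod 2) ℂ}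
  {T : Matrix.unitaryGroup (Fin r ⊕ Fin r → ZMod 2) ℂ}
  {φ : (Fin r → ZMod 2) → ℂ} {hφ : ∀ w, φ w * star (φ w) = 1}

lemma forall_mem_layer {ι : Type} [Fintype ι] {N M : ℕ} {op : ι → Op n N M}
    {p : Op n N M → Prop} (h : ∀ i, p (op i)) : ∀ o ∈ layer op, p o := by
  simpa [layer] using h

/-- The phase gates attain the bound: `r` qubits, `r` shift bits and one input bit. -/
lemma modCircuit_fanInLE : (modCircuit n k₀ U W H T φ hφ).FanInLE (2 * r + 1) := by
  change ∀ L ∈ ([prepareSource n U, preparePairs n T, connect n r, measureLinks n r,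
    queryShifts n r, applyPhases n H φ hφ, measureRegs n r, queryCorrection n r, decode n W,
    measureOut n k₀] : List (List (Op n (Fintype.card (Qubit n r)) (Fintype.card (WorkBit n r))))),
    ∀ o ∈ L, o.fanIn ≤ 2 * r + 1
  simp only [List.forall_mem_cons, List.not_mem_nil, false_implies, implies_true, and_true]
  refine ⟨?_, ?_, ?_, ?_, ?_, ?_, ?_, ?_, ?_, ?_⟩ <;> refine forall_mem_layer fun i => ?_ <;>
    simp only [gateOp, measureOp, queryOp, Op.fanIn, Fintype.card_sum, Fintype.card_fin,
      Fintype.card_option, Fintype.card_eq_zero] <;> omega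

/-- The bound is left unsimplified, one summand per layer, so that `gcongr` can match it. The shift
queries account for the quadratic term. -/
lemma modCircuit_size_le : (modCircuit n k₀ U W H T φ hφ).size ≤
    n + ((n + 1) * r + n * r) + (n * r + (n * r + (n * r + (r + 1)))) +
      (1 * (r + 1) + (n * (2 * r + 1) + (n * (2 * r + 1) + (n * r * 2 + (n * r * (n + 1) +
        (n * (2 * r + 2) + (n * r * 2 + (r * (n + 1) + (1 * (2 * r + 1) + 1 * 2))))))))) := by
  simp only [size, modCircuit, List.flatten_cons, List.flatten_nil, List.append_nil,
    List.map_append, List.sum_append]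
  gcongr
  · simp
  · simp
  · refine (sum_size_layer_le (c := r + 1) fun i => ?_).trans (by simp)
    simp [gateOp, Op.size]
  · refine (sum_size_layer_le (c := 2 * r + 1) fun i => ?_).trans (by simp)
    simp [gateOp, Op.size, two_mul]
  · refine (sum_size_layer_le (c := 2 * r + 1) fun i => ?_).trans (by simp)
    simp [gateOp, Op.size, two_mul]
  · refine (sum_size_layer_le (c := 2) fun i => ?_).trans (by simp)
    simp [measureOp, Op.size]
  · refine (sum_size_layer_le (c := n + 1) fun i => ?_).trans (by simp)
    have := Fintype.card_subtype_le fun j : Fin n => j ≤ i.1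
    rw [Fintype.card_fin] at this
    exact Nat.succ_le_succ this
  · refine (sum_size_layer_le (c := 2 * r + 2) fun i => ?_).trans (by simp)
    simp only [gateOp, Op.size, Fintype.card_fin, Fintype.card_option]
    omega
  · refine (sum_size_layer_le (c := 2) fun i => ?_).trans (by simp)
    simp [measureOp, Op.size]
  · refine (sum_size_layer_le (c := n + 1) fun i => ?_).trans (by simp)
    simp [queryOp, Op.size]
  · refine (sum_size_layer_le (c := 2 * r + 1) fun i => ?_).trans (by simp)
    simp [gateOp, Op.size, two_mul]
  · refine (sum_size_layer_le (c := 2) fun i => ?_).trans (by simp)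
    simp [measureOp, Op.size]

lemma modCircuit_computes {α : (Fin r → ZMod 2) → ℂ} {h c : ℂ}
    (hU : ∀ w, (U : Matrix (Fin r → ZMod 2) (Fin r → ZMod 2) ℂ) w 0 = α w)
    (hH : ∀ v w, (H : Matrix (Fin r → ZMod 2) (Fin r → ZMod 2) ℂ) v w = h * sign (v ⬝ᵥ w))
    (hT : ∀ w, (T : Matrix (Fin r ⊕ Fin r → ZMod 2) (Fin r ⊕ Fin r → ZMod 2) ℂ) w 0 =
      c * if ∀ k, w (Sum.inl k) = w (Sum.inr k) then 1 else 0)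
    {f : ℕ → ZMod 2}
    (hW : ∀ (m : ℕ) (v : Fin r → ZMod 2), v k₀ ≠ f m →
      ∑ w, (W : Matrix (Fin r → ZMod 2) (Fin r → ZMod 2) ℂ) v w * (α w * φ w ^ m) = 0) :
    (modCircuit n k₀ U W H T φ hφ).Computes (modFn 2 0) fun x => f (hammingNorm x) := by
  refine computes_of_forall_branch _ _ _ fun x b hb hne => ?_
  have key := (triple_prepareSource (g := modFn 2 0) (x := x) hU).append <|
    (triple_preparePairs α hT).append <| (triple_connect α).append <|
    (triple_measureLinks α).append <| (triple_queryShifts α).append <|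
    (triple_applyPhases hH φ α hφ).append <| (triple_measureRegs φ α).append <|
    (triple_queryCorrection φ α).append <| (triple_decode W φ α).append <|
    (triple_measureOut W φ α k₀ (f (hammingNorm x)) (hW _)).append <| Triple.nil _ _
  have hinit : ∀ b ∈ [(modCircuit n k₀ U W H T φ hφ).init x],
      Holds (InState x fun _ z => if z = 0 then 1 else 0) b := by
    intro b hb
    obtain rfl := List.mem_singleton.1 hb
    refine ⟨fun i => rfl, 1, fun z => ?_⟩
    have hz : z ∘ (Fintype.equivFin (Qubit n r)).symm = 0 ↔ z = 0 := by
      constructor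
      · intro h0
        funext y
        simpa using congrFun h0 (Fintype.equivFin (Qubit n r) y)
      · rintro rfl
        rfl
    change (Pi.single 0 1 : (Fin (Fintype.card (Qubit n r)) → ZMod 2) → ℂ)
      (z ∘ (Fintype.equivFin (Qubit n r)).symm) = 1 * if z = 0 then 1 else 0
    rw [one_mul]
    by_cases h0 : z = 0
    · rw [if_pos h0, hz.2 h0]
      exact Pi.single_eq_same _ _
    · rw [if_neg h0]
      exact Pi.single_eq_of_ne (mt hz.1 h0) _
  have h0 := key _ hinit b hb hne
  funext z
  have hz : (z ∘ Fintype.equivFin (Qubit n r)) ∘ (Fintype.equivFin (Qubit n r)).symm = z := by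
    funext y
    exact congrArg z ((Fintype.equivFin (Qubit n r)).apply_symm_apply y)
  have h1 := congrFun h0 (z ∘ Fintype.equivFin (Qubit n r))
  rw [← hz]
  exact h1

end ModCircuit

end QCircuit

open QCircuit Polynomial in
theorem qnc0Reducible_modFn {p : ℕ} (hp : 0 < p) : QNC0Reducible (modFn p 0) (modFn 2 0) := by
  obtain ⟨k₀, φ, α, U, W, hφ, hU, hW⟩ := exists_modular_phases hp
  obtain ⟨h, H, hH⟩ := exists_hadamard p
  -- The maximally entangled state of two registers, unnormalized; its value at the zero string
  -- shows that it is nonzero.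
  obtain ⟨T, c, hT⟩ := exists_unitary_column (0 : Fin p ⊕ Fin p → ZMod 2)
    (fun w => if ∀ k, w (Sum.inl k) = w (Sum.inr k) then 1 else 0)
    (fun h0 => by simpa using congrFun h0 0)
  -- Registers have `r = p` qubits and there are ten layers. The polynomial copies
  -- `modCircuit_size_le` term by term, so evaluating it reproduces that bound.
  refine ⟨2 * p + 1, 10,
    X + ((X + 1) * C p + X * C p) + (X * C p + (X * C p + (X * C p + (C p + 1)))) +
      (1 * (C p + 1) + (X * (2 * C p + 1) + (X * (2 * C p + 1) + (X * C p * 2 +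
        (X * C p * (X + 1) + (X * (2 * C p + 2) + (X * C p * 2 + (C p * (X + 1) +
          (1 * (2 * C p + 1) + 1 * 2))))))))), fun n => ⟨modCircuit n k₀ U W H T φ hφ,
    modCircuit_fanInLE, le_rfl, ?_, modCircuit_computes hU hH hT hW⟩⟩
  refine modCircuit_size_le.trans (le_of_eq ?_)
  simp

theorem mainTheorem4 (p : ℕ) (hp : p.Prime) : QNC0Reducible (modFn p 0) (modFn 2 0) :=
  qnc0Reducible_modFn hp.pos
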